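/- Let $K$ be a field and $Q=(Q_0,Q_1,s,r)$ an arbitrary quiver. The Kronecker square $\widehat Q$ has vertices $[u,v]$ ($u,v\in Q_0$) and arrows $[e,f]$ ($e,f\in Q_1$) with source $[s(e),s(f)]$ and range $[r(e),r(f)]$. For a quiver $E$ let $L_K(E)$ be its Leavitt path algebra: the associative, not necessarily unital, $K$-algebra generated by the vertices $v$, the arrows $e$ and the ghost arrows $e^*$, subject to $vw=\delta_{v,w}v$; $s(e)e=e=e\,r(e)$; $r(e)e^*=e^*=e^*s(e)$; $e^*f=\delta_{e,f}r(e)$; and $v=\sum_{s(e)=v}ee^*$ for every vertex $v$ that emits at least one and only finitely many arrows. It is $\mathbb Z$-graded, with $L_K(E)_n$ spanned by the elements $\alpha\beta^*$ where $\alpha,\beta$ are paths, $r(\alpha)=r(\beta)$ and $|\alpha|-|\beta|=n$. For a vertex $u$ let $T(u)$ be the set of all vertices reachable from $u$ by a (possibly trivial) path. A vertex $u$ is a sink if it emits no arrow. It is a ray point if $T(u)$ is a straight line segment, finite or infinite, that is, no vertex of $T(u)$ emits two or more arrows or lies on a cycle. It is a Laurent vertex if $T(u)$ is a finite straight line segment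 ending at a cycle without exits, that is, $T(u)$ is finite, no vertex of $T(u)$ emits two or more arrows, and some vertex of $T(u)$ is the base of a cycle without exits. Let $S\subseteq L_K(\widehat Q)$ be the diagonal copy of $L_K(Q)$: the (not necessarily unital) $K$-subalgebra generated by all $[v,v]$, $[e,e]$ and $[e,e]^*$ with $v\in Q_0$, $e\in Q_1$. Suppose that $S$ is a two-sided ideal of $L_K(\widehat Q)$. Then: (a) every vertex of $Q$ is a sink, a ray point or a Laurent vertex; (b) $L_K(\widehat Q)$ is a graded semisimple ring: as a left module over itself it is a direct sum of graded simple left ideals, and as a right module over itself it is a direct sum of graded simple right ideals; (c) the assignment $v\mapsto[v,v]$, $e\mapsto[e,e]$, $e^*\mapsto[e,e]^*$ extends to an injective $K$-algebra homomorphism $\varphi:L_K(Q)\to L_K(\widehat Q)$ with image $S$ and with $\varphi(x)\in L_K(\widehat Q)_n$ if and only if $x\in L_K(Q)_n$; the ideal $S$ is homogeneous; and the resulting graded exact sequence $$0\to L_K(Q)\xrightarrow{\ \varphi\ } L_K(\widehat Q)\to L_K(\widehat Q)/S\to 0$$ splits both as a sequence of graded left $L_K(\widehat Q)$-modules and as a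 sequence of graded right $L_K(\widehat Q)$-modules, by degree-preserving module homomorphisms. -/

import Mathlib

universe v u

namespace Leavitt

/-! ### Quivers -/

section QuiverNotions

variable {V : Type u} [Quiver.{v} V]

/-- The arrows emitted by the vertex `a`. -/
def emitted (a : V) : Set (Quiver.Total V) := {e | e.left = a}

/-- A sink emits no arrow. -/
def IsSink (a : V) : Prop := emitted a = ∅

/-- A regular vertex emits at least one and only finitely many arrows. -/
def IsRegular (a : V) : Prop := (emitted a).Nonempty ∧ (emitted a).Finite

/-- There is a bifurcation at `a` if `a` emits at least two arrows. -/
def IsBifurcation (a : V) : Prop := (emitted a).Nontrivial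

/-- The tree `T(a)`: all vertices that can be reached from `a` by a path
(the trivial path included). -/
def tree (a : V) : Set V := {w | Nonempty (Quiver.Path a w)}

/-- The list of arrows `e₁, …, eₙ` of a path `e₁ ⋯ eₙ`. -/
def arrows {a : V} : {b : V} → Quiver.Path a b → List (Quiver.Total V)
  | _, .nil => []
  | _, .cons p e => arrows p ++ [⟨_, _, e⟩]

/-- A cycle is a closed path `e₁ ⋯ eₙ` with `n ≥ 1` and `s(eᵢ) ≠ s(eⱼ)` for `i ≠ j`. -/
def IsCycle {a : V} (c : Quiver.Path a a) : Prop :=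
  0 < c.length ∧ ((arrows c).map Quiver.Total.left).Nodup

/-- A path has an exit if some arrow `f` satisfies `s(f) = s(eᵢ)` and `f ≠ eᵢ` for
one of the arrows `eᵢ` of the path. -/
def HasExit {a b : V} (p : Quiver.Path a b) : Prop :=
  ∃ e ∈ arrows p, ∃ f : Quiver.Total V, f.left = e.left ∧ f ≠ e

/-- `a` is a ray point if its tree is a straight line segment, finite or infinite: the tree
contains neither bifurcations nor cycles. -/
def IsRayPoint (a : V) : Prop :=
  ∀ w ∈ tree a, ¬ IsBifurcation w ∧ ∀ c : Quiver.Path w w, ¬ IsCycle c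

/-- `a` is a Laurent vertex if its tree is a finite straight line segment, without bifurcations,
ending at a cycle without exits. -/
def IsLaurentVertex (a : V) : Prop :=
  (tree a).Finite ∧ (∀ w ∈ tree a, ¬ IsBifurcation w) ∧
    ∃ w ∈ tree a, ∃ c : Quiver.Path w w, IsCycle c ∧ ¬ HasExit c

end QuiverNotions

/-- The vertices of the Kronecker square of a quiver: pairs `[a, b]` of vertices. -/
@[ext]
structure KroneckerSquare (V : Type u) : Type u where
  fst : V
  snd : V

/-- The arrows of the Kronecker square: pairs `[e, f]` of arrows, from `[s(e), s(f)]` to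
`[r(e), r(f)]`. -/
instance (V : Type u) [Quiver.{v} V] : Quiver.{v} (KroneckerSquare V) where
  Hom x y := (x.fst ⟶ y.fst) × (x.snd ⟶ y.snd)

/-- The arrow `[e, f]` of the Kronecker square. -/
def pairArrow {V : Type u} [Quiver.{v} V] (e f : Quiver.Total V) :
    Quiver.Total (KroneckerSquare V) where
  left := ⟨e.left, f.left⟩
  right := ⟨e.right, f.right⟩
  hom := (e.hom, f.hom)

/-! ### The Leavitt path algebra -/

/-- The generators of the Leavitt path algebra: vertices `a`, arrows `e`, ghost arrows `e*`. -/
inductive Generator (V : Type u) [Quiver.{v} V] : Type (max u v)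
  | vertex (a : V)
  | arrow (e : Quiver.Total V)
  | ghost (e : Quiver.Total V)

/-- The free associative (not necessarily unital) `K`-algebra on the generators. -/
abbrev FreeAlg (K : Type*) [Field K] (V : Type u) [Quiver.{v} V] :=
  MonoidAlgebra K (FreeSemigroup (Generator V))

section Presentation

variable (K : Type*) [Field K] (V : Type u) [Quiver.{v} V]

/-- A generator as an element of the free algebra. -/
noncomputable def FreeAlg.of (x : Generator V) : FreeAlg K V :=
  MonoidAlgebra.single (FreeSemigroup.of x) 1

open Generator in
/-- The defining relations of the Leavitt path algebra. The last constructor makes sure that the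
ideal they generate is closed under scalars: the free algebra has no unit. -/
inductive Relation : FreeAlg K V → FreeAlg K V → Prop
  | vertex_mul_self (a : V) :
      Relation (FreeAlg.of K V (vertex a) * FreeAlg.of K V (vertex a)) (FreeAlg.of K V (vertex a))
  | vertex_mul_vertex (a b : V) (h : a ≠ b) :
      Relation (FreeAlg.of K V (vertex a) * FreeAlg.of K V (vertex b)) 0
  | left_mul_arrow (e : Quiver.Total V) :
      Relation (FreeAlg.of K V (vertex e.left) * FreeAlg.of K V (arrow e))
        (FreeAlg.of K V (arrow e))
  | arrow_mul_right (e : Quiver.Total V) :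
      Relation (FreeAlg.of K V (arrow e) * FreeAlg.of K V (vertex e.right))
        (FreeAlg.of K V (arrow e))
  | right_mul_ghost (e : Quiver.Total V) :
      Relation (FreeAlg.of K V (vertex e.right) * FreeAlg.of K V (ghost e))
        (FreeAlg.of K V (ghost e))
  | ghost_mul_left (e : Quiver.Total V) :
      Relation (FreeAlg.of K V (ghost e) * FreeAlg.of K V (vertex e.left))
        (FreeAlg.of K V (ghost e))
  | ghost_mul_arrow_self (e : Quiver.Total V) :
      Relation (FreeAlg.of K V (ghost e) * FreeAlg.of K V (arrow e))
        (FreeAlg.of K V (vertex e.right))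
  | ghost_mul_arrow (e f : Quiver.Total V) (h : e ≠ f) :
      Relation (FreeAlg.of K V (ghost e) * FreeAlg.of K V (arrow f)) 0
  | cuntz_krieger (a : V) (h : IsRegular a) :
      Relation (FreeAlg.of K V (vertex a))
        (∑ e ∈ h.2.toFinset, FreeAlg.of K V (arrow e) * FreeAlg.of K V (ghost e))
  | smul (k : K) {x y : FreeAlg K V} (h : Relation x y) : Relation (k • x) (k • y)

/-- The ring congruence generated by the defining relations. -/
noncomputable def leavittCon : RingCon (FreeAlg K V) := ringConGen (Relation K V)

theorem leavittCon_smul (k : K) {x y : FreeAlg K V} (h : leavittCon K V x y) :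
    leavittCon K V (k • x) (k • y) := by
  change RingConGen.Rel (Relation K V) x y at h
  change RingConGen.Rel (Relation K V) (k • x) (k • y)
  induction h with
  | of x y h => exact .of _ _ (.smul k h)
  | refl x => exact .refl _
  | symm _ ih => exact .symm ih
  | trans _ _ ih₁ ih₂ => exact .trans ih₁ ih₂
  | add _ _ ih₁ ih₂ => rw [smul_add, smul_add]; exact .add ih₁ ih₂
  | mul _ h₂ ih₁ _ =>
    rw [← smul_mul_assoc, ← smul_mul_assoc]
    exact .mul ih₁ h₂

/-- The Leavitt path algebra `L_K(Q)` of a quiver `Q` with vertex set `V`, as an associative, not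
necessarily unital, `K`-algebra given by generators and relations. -/
def LeavittPathAlgebra : Type _ := (leavittCon K V).Quotient

noncomputable instance : NonUnitalRing (LeavittPathAlgebra K V) :=
  inferInstanceAs (NonUnitalRing (leavittCon K V).Quotient)

/-- The quotient map from the free algebra. -/
noncomputable def LeavittPathAlgebra.mk : FreeAlg K V →ₙ+* LeavittPathAlgebra K V where
  toFun x := ((x : (leavittCon K V).Quotient) : LeavittPathAlgebra K V)
  map_mul' _ _ := rfl
  map_zero' := rfl
  map_add' _ _ := rfl

theorem LeavittPathAlgebra.mk_surjective :
    Function.Surjective (LeavittPathAlgebra.mk K V) :=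
  fun x => Quotient.exists_rep x

noncomputable instance : SMul K (LeavittPathAlgebra K V) where
  smul k := Quotient.map' (fun x => k • x) (fun _ _ h => leavittCon_smul K V k h)

theorem LeavittPathAlgebra.mk_smul (k : K) (x : FreeAlg K V) :
    LeavittPathAlgebra.mk K V (k • x) = k • LeavittPathAlgebra.mk K V x := rfl

noncomputable instance : Module K (LeavittPathAlgebra K V) :=
  Function.Surjective.module K (LeavittPathAlgebra.mk K V).toAddMonoidHom
    (LeavittPathAlgebra.mk_surjective K V) (LeavittPathAlgebra.mk_smul K V)

instance : IsScalarTower K (LeavittPathAlgebra K V) (LeavittPathAlgebra K V) where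
  smul_assoc k x y := by
    obtain ⟨x, rfl⟩ := LeavittPathAlgebra.mk_surjective K V x
    obtain ⟨y, rfl⟩ := LeavittPathAlgebra.mk_surjective K V y
    simp only [smul_eq_mul, ← LeavittPathAlgebra.mk_smul, ← map_mul, smul_mul_assoc]

instance : SMulCommClass K (LeavittPathAlgebra K V) (LeavittPathAlgebra K V) where
  smul_comm k x y := by
    obtain ⟨x, rfl⟩ := LeavittPathAlgebra.mk_surjective K V x
    obtain ⟨y, rfl⟩ := LeavittPathAlgebra.mk_surjective K V y
    simp only [smul_eq_mul, ← LeavittPathAlgebra.mk_smul, ← map_mul, mul_smul_comm]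

end Presentation

section Elements

variable (K : Type*) [Field K] {V : Type u} [Quiver.{v} V]

/-- The element `a` of `L_K(Q)`, for a vertex `a`. -/
noncomputable def vertex (a : V) : LeavittPathAlgebra K V :=
  LeavittPathAlgebra.mk K V (FreeAlg.of K V (.vertex a))

/-- The element `e` of `L_K(Q)`, for an arrow `e`. -/
noncomputable def arrow (e : Quiver.Total V) : LeavittPathAlgebra K V :=
  LeavittPathAlgebra.mk K V (FreeAlg.of K V (.arrow e))

/-- The element `e*` of `L_K(Q)`, for an arrow `e`. -/
noncomputable def ghost (e : Quiver.Total V) : LeavittPathAlgebra K V :=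
  LeavittPathAlgebra.mk K V (FreeAlg.of K V (.ghost e))

/-- The element `e₁ ⋯ eₙ` of `L_K(Q)`, for a path `e₁ ⋯ eₙ`; a vertex, for a trivial path. -/
noncomputable def pathElt {a : V} : {b : V} → Quiver.Path a b → LeavittPathAlgebra K V
  | _, .nil => vertex K a
  | _, .cons p e => pathElt p * arrow K ⟨_, _, e⟩

/-- The element `eₙ* ⋯ e₁*` of `L_K(Q)`, for a path `e₁ ⋯ eₙ`; a vertex, for a trivial path. -/
noncomputable def ghostPathElt {a : V} : {b : V} → Quiver.Path a b → LeavittPathAlgebra K V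
  | _, .nil => vertex K a
  | _, .cons p e => ghost K ⟨_, _, e⟩ * ghostPathElt p

variable (V) in
/-- The homogeneous component of degree `n` of `L_K(Q)`: the span of all `α β*` with
`r(α) = r(β)` and `|α| - |β| = n`. -/
noncomputable def component (n : ℤ) : Submodule K (LeavittPathAlgebra K V) :=
  Submodule.span K {x | ∃ (a b c : V) (α : Quiver.Path a c) (β : Quiver.Path b c),
    (α.length : ℤ) - (β.length : ℤ) = n ∧ x = pathElt K α * ghostPathElt K β}

variable (V) in
/-- The diagonal copy of `L_K(Q)` in the Leavitt path algebra of the Kronecker square: the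
subalgebra generated by all `[a, a]`, `[e, e]` and `[e, e]*`. -/
noncomputable def diagonalSubalgebra :
    NonUnitalSubalgebra K (LeavittPathAlgebra K (KroneckerSquare V)) :=
  NonUnitalAlgebra.adjoin K
    (Set.range (fun a : V => vertex K (⟨a, a⟩ : KroneckerSquare V)) ∪
      Set.range (fun e : Quiver.Total V => arrow K (pairArrow e e)) ∪
      Set.range (fun e : Quiver.Total V => ghost K (pairArrow e e)))

/-- A homomorphism `L_K(Q) → L_K(Q̂)` is diagonal if `a ↦ [a, a]`, `e ↦ [e, e]` and
`e* ↦ [e, e]*`. -/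
def IsDiagonal
    (φ : LeavittPathAlgebra K V →ₙₐ[K] LeavittPathAlgebra K (KroneckerSquare V)) : Prop :=
  (∀ a : V, φ (vertex K a) = vertex K (⟨a, a⟩ : KroneckerSquare V)) ∧
  (∀ e : Quiver.Total V, φ (arrow K e) = arrow K (pairArrow e e)) ∧
  (∀ e : Quiver.Total V, φ (ghost K e) = ghost K (pairArrow e e))

end Elements

/-! ### Graded ideals, graded semisimplicity, graded splitting

`A` is an associative, not necessarily unital, `K`-algebra with a family `𝒜` of homogeneous
components. A left ideal of a ring with local units is automatically a `K`-subspace, so left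
ideals are taken as `K`-subspaces; the same for right ideals. -/

section Graded

variable {K A : Type*} [Field K] [NonUnitalRing A] [Module K A]

def IsLeftIdeal (I : Submodule K A) : Prop := ∀ a : A, ∀ x ∈ I, a * x ∈ I

def IsRightIdeal (I : Submodule K A) : Prop := ∀ a : A, ∀ x ∈ I, x * a ∈ I

/-- `I` is spanned by its homogeneous elements. -/
def IsHomogeneous (𝒜 : ℤ → Submodule K A) (I : Submodule K A) : Prop :=
  I ≤ ⨆ n, I ⊓ 𝒜 n

/-- The left ideal `I` is homogeneous and is a graded simple left module: `A I ≠ 0`, and the only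
homogeneous left ideals inside `I` are `0` and `I`. -/
structure IsGradedSimpleLeft (𝒜 : ℤ → Submodule K A) (I : Submodule K A) : Prop where
  isLeftIdeal : IsLeftIdeal I
  isHomogeneous : IsHomogeneous 𝒜 I
  mul_ne_zero : ∃ a : A, ∃ x ∈ I, a * x ≠ 0
  eq_bot_or_eq : ∀ J ≤ I, IsLeftIdeal J → IsHomogeneous 𝒜 J → J = ⊥ ∨ J = I

/-- The right ideal `I` is homogeneous and is a graded simple right module. -/
structure IsGradedSimpleRight (𝒜 : ℤ → Submodule K A) (I : Submodule K A) : Prop where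
  isRightIdeal : IsRightIdeal I
  isHomogeneous : IsHomogeneous 𝒜 I
  mul_ne_zero : ∃ a : A, ∃ x ∈ I, x * a ≠ 0
  eq_bot_or_eq : ∀ J ≤ I, IsRightIdeal J → IsHomogeneous 𝒜 J → J = ⊥ ∨ J = I

/-- `A` is graded semisimple: as a left module over itself it is the direct sum of graded simple
left ideals, and likewise on the right. -/
def IsGradedSemisimple (𝒜 : ℤ → Submodule K A) : Prop :=
  (∃ 𝓢 : Set (Submodule K A),
    (∀ I ∈ 𝓢, IsGradedSimpleLeft 𝒜 I) ∧ sSupIndep 𝓢 ∧ sSup 𝓢 = ⊤) ∧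
  (∃ 𝓢 : Set (Submodule K A),
    (∀ I ∈ 𝓢, IsGradedSimpleRight 𝒜 I) ∧ sSupIndep 𝓢 ∧ sSup 𝓢 = ⊤)

/-- For a left ideal `I`, the projection `A → A / I` has a section that is a degree-preserving
homomorphism of left `A`-modules, where `a · (x + I) = a x + I` and `A / I` carries the quotient
grading. -/
def SplitsLeft (𝒜 : ℤ → Submodule K A) (I : Submodule K A) : Prop :=
  ∃ σ : (A ⧸ I) →ₗ[K] A, (∀ y, I.mkQ (σ y) = y) ∧
    (∀ a x : A, σ (I.mkQ (a * x)) = a * σ (I.mkQ x)) ∧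
    ∀ n : ℤ, ∀ x ∈ 𝒜 n, σ (I.mkQ x) ∈ 𝒜 n

/-- For a right ideal `I`, the projection `A → A / I` has a section that is a degree-preserving
homomorphism of right `A`-modules. -/
def SplitsRight (𝒜 : ℤ → Submodule K A) (I : Submodule K A) : Prop :=
  ∃ σ : (A ⧸ I) →ₗ[K] A, (∀ y, I.mkQ (σ y) = y) ∧
    (∀ a x : A, σ (I.mkQ (x * a)) = σ (I.mkQ x) * a) ∧
    ∀ n : ℤ, ∀ x ∈ 𝒜 n, σ (I.mkQ x) ∈ 𝒜 n

end Graded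

end Leavitt

/-! Everything follows from one fact: if `S` is a right ideal, no vertex of `Q` emits two arrows.
Suppose `e ≠ f` have the same source `u`. Then `[e, f] = [u, u][e, f]` lies in `S`. But `[e, f]` is
never in `S` (`arrow_pairArrow_notMem`): there are two representations of the Leavitt path algebra
of the Kronecker square that agree on all generators of `S` and differ at `[e, f]`.

Without bifurcations, in `Q` and hence in its Kronecker square, paths from a vertex are determined
by their length. A tree that contains a cycle is then finite, which gives (a). The Cuntz-Krieger
relation becomes `e e* = s(e)`, so each monomial `α β*` has inverse `β α*` relative to the vertices
at its ends, and depends only on those vertices and its degree (`NoBifurcations.monomial_eq`). A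
representation on `V × ℤ` shows that different monomials are linearly independent. The algebra thus
has at most a line of elements of each degree between two given vertices, spanned by an invertible
monomial. Hence the left and right ideals generated by a vertex are graded simple, and their sums
over all vertices give (b).

For (c), the coefficients at monomials are preserved by the diagonal map, so it is injective and
preserves and reflects degrees. The ideal `S` is the sum of the corners at the diagonal vertices
`[a, a]`; the sum of the other corners is a graded complement, which splits the sequence. -/

namespace Leavitt

/-! ### Relations and induction on generators -/

section Basic

variable {K : Type*} [Field K] {V : Type u} [Quiver.{v} V]

theorem mk_eq_of_relation {x y : FreeAlg K V} (h : Relation K V x y) :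
    LeavittPathAlgebra.mk K V x = LeavittPathAlgebra.mk K V y :=
  Quotient.sound (RingCon.le_ringConGen (r := Relation K V) _ _ h)

theorem vertex_mul_self (a : V) : vertex K a * vertex K a = vertex K a :=
  mk_eq_of_relation (.vertex_mul_self a)

theorem vertex_mul_of_ne {a b : V} (h : a ≠ b) : vertex K a * vertex K b = 0 :=
  mk_eq_of_relation (.vertex_mul_vertex a b h)

theorem left_mul_arrow (e : Quiver.Total V) : vertex K e.left * arrow K e = arrow K e :=
  mk_eq_of_relation (.left_mul_arrow e)

theorem arrow_mul_right (e : Quiver.Total V) : arrow K e * vertex K e.right = arrow K e :=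
  mk_eq_of_relation (.arrow_mul_right e)

theorem right_mul_ghost (e : Quiver.Total V) : vertex K e.right * ghost K e = ghost K e :=
  mk_eq_of_relation (.right_mul_ghost e)

theorem ghost_mul_left (e : Quiver.Total V) : ghost K e * vertex K e.left = ghost K e :=
  mk_eq_of_relation (.ghost_mul_left e)

theorem ghost_mul_arrow_self (e : Quiver.Total V) : ghost K e * arrow K e = vertex K e.right :=
  mk_eq_of_relation (.ghost_mul_arrow_self e)

theorem ghost_mul_arrow_of_ne {e f : Quiver.Total V} (h : e ≠ f) : ghost K e * arrow K f = 0 :=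
  mk_eq_of_relation (.ghost_mul_arrow e f h)

theorem cuntz_krieger (a : V) (h : IsRegular a) :
    vertex K a = ∑ e ∈ h.2.toFinset, arrow K e * ghost K e := by
  have := mk_eq_of_relation (K := K) (.cuntz_krieger a h)
  rw [map_sum] at this
  exact this.trans (Finset.sum_congr rfl fun e _ => map_mul _ _ _)

theorem LeavittPathAlgebra.induction {P : LeavittPathAlgebra K V → Prop}
    (hv : ∀ a, P (vertex K a)) (ha : ∀ e, P (arrow K e)) (hg : ∀ e, P (ghost K e))
    (hzero : P 0) (hadd : ∀ x y, P x → P y → P (x + y))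
    (hmul : ∀ x y, P x → P y → P (x * y)) (hsmul : ∀ (k : K) x, P x → P (k • x))
    (x : LeavittPathAlgebra K V) : P x := by
  obtain ⟨x, rfl⟩ := LeavittPathAlgebra.mk_surjective K V x
  have key : ∀ w : FreeSemigroup (Generator V),
      P (LeavittPathAlgebra.mk K V (MonoidAlgebra.single w 1)) := by
    have hof : ∀ g : Generator V,
        P (LeavittPathAlgebra.mk K V (MonoidAlgebra.single (FreeSemigroup.of g) 1)) := by
      rintro (a | e | e)
      exacts [hv a, ha e, hg e]
    intro w
    induction w using FreeSemigroup.recOnMul with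
    | ih1 g => exact hof g
    | ih2 g w hg hw =>
      rw [show (MonoidAlgebra.single (FreeSemigroup.of g * w) 1 : FreeAlg K V) =
        MonoidAlgebra.single (FreeSemigroup.of g) 1 * MonoidAlgebra.single w 1 by
          rw [MonoidAlgebra.single_mul_single, one_mul], map_mul]
      exact hmul _ _ hg hw
  induction x using MonoidAlgebra.induction_linear with
  | zero => rwa [map_zero]
  | add x y hx hy => rw [map_add]; exact hadd _ _ hx hy
  | single w k =>
    rw [show (MonoidAlgebra.single w k : FreeAlg K V) = k • MonoidAlgebra.single w 1 by simp,
      LeavittPathAlgebra.mk_smul]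
    exact hsmul _ _ (key w)

end Basic

/-! ### The universal property -/

section Lift

variable (K : Type*) [Field K] {V : Type u} [Quiver.{v} V]
variable {B : Type*} [NonUnitalRing B] [Module K B] [IsScalarTower K B B] [SMulCommClass K B B]

/-- A family of elements of an algebra which satisfies the relations of `L_K(Q)`. -/
structure IsLeavittFamily (p : V → B) (s t : Quiver.Total V → B) : Prop where
  vertex_mul_self : ∀ a, p a * p a = p a
  vertex_mul_vertex : ∀ a b, a ≠ b → p a * p b = 0
  left_mul_arrow : ∀ e, p e.left * s e = s e
  arrow_mul_right : ∀ e, s e * p e.right = s e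
  right_mul_ghost : ∀ e, p e.right * t e = t e
  ghost_mul_left : ∀ e, t e * p e.left = t e
  ghost_mul_arrow_self : ∀ e, t e * s e = p e.right
  ghost_mul_arrow : ∀ e f, e ≠ f → t e * s f = 0
  cuntz_krieger : ∀ (a : V) (h : IsRegular a), p a = ∑ e ∈ h.2.toFinset, s e * t e

/-- The value of a family on a generator. -/
def generatorValue (p : V → B) (s t : Quiver.Total V → B) : Generator V → B
  | .vertex a => p a
  | .arrow e => s e
  | .ghost e => t e

/-- The homomorphism from the free algebra that is given on generators. -/
noncomputable def freeLift (p : V → B) (s t : Quiver.Total V → B) : FreeAlg K V →ₙₐ[K] B :=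
  MonoidAlgebra.liftMagma K (FreeSemigroup.lift (generatorValue p s t))

theorem freeLift_of (p : V → B) (s t : Quiver.Total V → B) (g : Generator V) :
    freeLift K p s t (FreeAlg.of K V g) = generatorValue p s t g := by
  simp [freeLift, FreeAlg.of]

variable {K}

theorem IsLeavittFamily.freeLift_eq {p : V → B} {s t : Quiver.Total V → B}
    (h : IsLeavittFamily p s t) {x y : FreeAlg K V} (hxy : Relation K V x y) :
    freeLift K p s t x = freeLift K p s t y := by
  induction hxy with
  | smul k _ ih => rw [map_smul, map_smul, ih]
  | vertex_mul_self a => simpa [freeLift_of, generatorValue] using h.vertex_mul_self a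
  | vertex_mul_vertex a b hab => simpa [freeLift_of, generatorValue] using h.vertex_mul_vertex a b hab
  | left_mul_arrow e => simpa [freeLift_of, generatorValue] using h.left_mul_arrow e
  | arrow_mul_right e => simpa [freeLift_of, generatorValue] using h.arrow_mul_right e
  | right_mul_ghost e => simpa [freeLift_of, generatorValue] using h.right_mul_ghost e
  | ghost_mul_left e => simpa [freeLift_of, generatorValue] using h.ghost_mul_left e
  | ghost_mul_arrow_self e => simpa [freeLift_of, generatorValue] using h.ghost_mul_arrow_self e
  | ghost_mul_arrow e f hef => simpa [freeLift_of, generatorValue] using h.ghost_mul_arrow e f hef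
  | cuntz_krieger a ha =>
    rw [map_sum]
    simpa [freeLift_of, generatorValue] using h.cuntz_krieger a ha

theorem IsLeavittFamily.freeLift_eq_of_con {p : V → B} {s t : Quiver.Total V → B}
    (h : IsLeavittFamily p s t) {x y : FreeAlg K V} (hxy : leavittCon K V x y) :
    freeLift K p s t x = freeLift K p s t y := by
  change RingConGen.Rel (Relation K V) x y at hxy
  induction hxy with
  | of x y hxy => exact h.freeLift_eq hxy
  | refl x => rfl
  | symm _ ih => exact ih.symm
  | trans _ _ ih₁ ih₂ => exact ih₁.trans ih₂
  | add _ _ ih₁ ih₂ => rw [map_add, map_add, ih₁, ih₂]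
  | mul _ _ ih₁ ih₂ => rw [map_mul, map_mul, ih₁, ih₂]

/-- The universal property of the Leavitt path algebra. -/
noncomputable def IsLeavittFamily.lift {p : V → B} {s t : Quiver.Total V → B}
    (h : IsLeavittFamily p s t) : LeavittPathAlgebra K V →ₙₐ[K] B where
  toFun := Quotient.lift (freeLift K p s t) (fun _ _ hxy => h.freeLift_eq_of_con hxy)
  map_smul' k x := by
    obtain ⟨x, rfl⟩ := LeavittPathAlgebra.mk_surjective K V x
    exact map_smul (freeLift K p s t) k x
  map_zero' := map_zero (freeLift K p s t)
  map_add' x y := by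
    obtain ⟨x, rfl⟩ := LeavittPathAlgebra.mk_surjective K V x
    obtain ⟨y, rfl⟩ := LeavittPathAlgebra.mk_surjective K V y
    exact map_add (freeLift K p s t) x y
  map_mul' x y := by
    obtain ⟨x, rfl⟩ := LeavittPathAlgebra.mk_surjective K V x
    obtain ⟨y, rfl⟩ := LeavittPathAlgebra.mk_surjective K V y
    exact map_mul (freeLift K p s t) x y

variable {p : V → B} {s t : Quiver.Total V → B} (h : IsLeavittFamily p s t)

theorem IsLeavittFamily.lift_vertex (a : V) : h.lift (vertex K a) = p a :=
  freeLift_of K p s t (.vertex a)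

theorem IsLeavittFamily.lift_arrow (e : Quiver.Total V) : h.lift (arrow K e) = s e :=
  freeLift_of K p s t (.arrow e)

theorem IsLeavittFamily.lift_ghost (e : Quiver.Total V) : h.lift (ghost K e) = t e :=
  freeLift_of K p s t (.ghost e)

end Lift

/-! ### Representations on branching systems -/

section Branching

/-- A branching system: a set `X` lying over the vertices, with partial injections indexed by the
arrows, the ranges of which are disjoint and exhaust the fibres over regular vertices. -/
structure BranchingSystem (V : Type u) [Quiver.{v} V] (X : Type*) where
  proj : X → V
  step : Quiver.Total V → X → X
  proj_step : ∀ e x, proj x = e.right → proj (step e x) = e.left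
  step_inj : ∀ e f x y, proj x = e.right → proj y = f.right → step e x = step f y →
    e = f ∧ x = y
  exists_step : ∀ x, IsRegular (proj x) → ∃ e y, proj y = e.right ∧ step e y = x

namespace BranchingSystem

variable (K : Type*) [Field K] {V : Type u} [Quiver.{v} V] {X : Type*} (𝒳 : BranchingSystem V X)

open Classical in
/-- The projection onto the fibre over `a`. -/
noncomputable def vertexOp (a : V) : Module.End K (X →₀ K) :=
  Finsupp.linearCombination K (fun x => if 𝒳.proj x = a then Finsupp.single x 1 else 0)

open Classical in
/-- The partial injection of the arrow `e`. -/
noncomputable def arrowOp (e : Quiver.Total V) : Module.End K (X →₀ K) :=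
  Finsupp.linearCombination K
    (fun x => if 𝒳.proj x = e.right then Finsupp.single (𝒳.step e x) 1 else 0)

open Classical in
/-- The inverse of the partial injection of the arrow `e`. -/
noncomputable def ghostOp (e : Quiver.Total V) : Module.End K (X →₀ K) :=
  Finsupp.linearCombination K
    (fun x => if h : ∃ y, 𝒳.proj y = e.right ∧ 𝒳.step e y = x
      then Finsupp.single h.choose 1 else 0)

variable {K}

theorem vertexOp_single {a : V} {x : X} (h : 𝒳.proj x = a) :
    𝒳.vertexOp K a (Finsupp.single x 1) = Finsupp.single x 1 := by
  simp [vertexOp, h]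

theorem vertexOp_single_of_ne {a : V} {x : X} (h : 𝒳.proj x ≠ a) :
    𝒳.vertexOp K a (Finsupp.single x 1) = 0 := by
  simp [vertexOp, h]

theorem arrowOp_single {e : Quiver.Total V} {x : X} (h : 𝒳.proj x = e.right) :
    𝒳.arrowOp K e (Finsupp.single x 1) = Finsupp.single (𝒳.step e x) 1 := by
  simp [arrowOp, h]

theorem arrowOp_single_of_ne {e : Quiver.Total V} {x : X} (h : 𝒳.proj x ≠ e.right) :
    𝒳.arrowOp K e (Finsupp.single x 1) = 0 := by
  simp [arrowOp, h]

theorem ghostOp_single_step {e : Quiver.Total V} {x : X} (h : 𝒳.proj x = e.right) :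
    𝒳.ghostOp K e (Finsupp.single (𝒳.step e x) 1) = Finsupp.single x 1 := by
  have hex : ∃ y, 𝒳.proj y = e.right ∧ 𝒳.step e y = 𝒳.step e x := ⟨x, h, rfl⟩
  -- The chosen preimage is the only one, because each step is injective on its fibre.
  have hx : hex.choose = x := (𝒳.step_inj e e _ x hex.choose_spec.1 h hex.choose_spec.2).2
  simp only [ghostOp, Finsupp.linearCombination_single, one_smul]
  rw [dif_pos hex, hx]

theorem ghostOp_single_of_not {e : Quiver.Total V} {x : X}
    (h : ∀ y, 𝒳.proj y = e.right → 𝒳.step e y ≠ x) :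
    𝒳.ghostOp K e (Finsupp.single x 1) = 0 := by
  simp only [ghostOp, Finsupp.linearCombination_single, one_smul]
  rw [dif_neg]
  rintro ⟨y, hy, hyx⟩
  exact h y hy hyx

theorem end_ext {f g : Module.End K (X →₀ K)}
    (h : ∀ x, f (Finsupp.single x 1) = g (Finsupp.single x 1)) : f = g :=
  Finsupp.lhom_ext' fun x => LinearMap.ext_ring (h x)

/-- Disjointness of the ranges gives `e* f = 0` for `e ≠ f`, and exhaustion of the fibres over
regular vertices gives the Cuntz-Krieger relation; the other relations only track fibres. -/
theorem isLeavittFamily : IsLeavittFamily (𝒳.vertexOp K) (𝒳.arrowOp K) (𝒳.ghostOp K) where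
  vertex_mul_self a := end_ext fun x => by
    rw [Module.End.mul_apply]
    by_cases h : 𝒳.proj x = a
    · rw [vertexOp_single _ h, vertexOp_single _ h]
    · rw [vertexOp_single_of_ne _ h, map_zero]
  vertex_mul_vertex a b hab := end_ext fun x => by
    rw [Module.End.mul_apply]
    by_cases h : 𝒳.proj x = b
    · rw [vertexOp_single _ h, vertexOp_single_of_ne _ (by rw [h]; exact hab.symm)]
      rfl
    · rw [vertexOp_single_of_ne _ h, map_zero]
      rfl
  left_mul_arrow e := end_ext fun x => by
    rw [Module.End.mul_apply]
    by_cases h : 𝒳.proj x = e.right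
    · rw [arrowOp_single _ h, vertexOp_single _ (𝒳.proj_step e x h)]
    · rw [arrowOp_single_of_ne _ h, map_zero]
  arrow_mul_right e := end_ext fun x => by
    rw [Module.End.mul_apply]
    by_cases h : 𝒳.proj x = e.right
    · rw [vertexOp_single _ h]
    · rw [vertexOp_single_of_ne _ h, arrowOp_single_of_ne _ h, map_zero]
  right_mul_ghost e := end_ext fun x => by
    rw [Module.End.mul_apply]
    by_cases h : ∃ y, 𝒳.proj y = e.right ∧ 𝒳.step e y = x
    · obtain ⟨y, hy, rfl⟩ := h
      rw [ghostOp_single_step _ hy, vertexOp_single _ hy]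
    · rw [ghostOp_single_of_not _ (fun y hy hyx => h ⟨y, hy, hyx⟩), map_zero]
  ghost_mul_left e := end_ext fun x => by
    rw [Module.End.mul_apply]
    by_cases h : ∃ y, 𝒳.proj y = e.right ∧ 𝒳.step e y = x
    · obtain ⟨y, hy, rfl⟩ := h
      rw [vertexOp_single _ (𝒳.proj_step e y hy)]
    · rw [ghostOp_single_of_not _ (fun y hy hyx => h ⟨y, hy, hyx⟩)]
      by_cases hx : 𝒳.proj x = e.left
      · rw [vertexOp_single _ hx, ghostOp_single_of_not _ (fun y hy hyx => h ⟨y, hy, hyx⟩)]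
      · rw [vertexOp_single_of_ne _ hx, map_zero]
  ghost_mul_arrow_self e := end_ext fun x => by
    rw [Module.End.mul_apply]
    by_cases h : 𝒳.proj x = e.right
    · rw [arrowOp_single _ h, ghostOp_single_step _ h, vertexOp_single _ h]
    · rw [arrowOp_single_of_ne _ h, vertexOp_single_of_ne _ h, map_zero]
  ghost_mul_arrow e f hef := end_ext fun x => by
    rw [Module.End.mul_apply]
    by_cases h : 𝒳.proj x = f.right
    · rw [arrowOp_single _ h, ghostOp_single_of_not]
      · rfl
      · exact fun y hy hyx => hef (𝒳.step_inj e f y x hy h hyx).1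
    · rw [arrowOp_single_of_ne _ h, map_zero]
      rfl
  cuntz_krieger a ha := end_ext fun x => by
    simp only [LinearMap.sum_apply, Module.End.mul_apply]
    by_cases h : 𝒳.proj x = a
    · subst h
      obtain ⟨e, y, hy, rfl⟩ := 𝒳.exists_step x ha
      -- The basis point lies in the range of exactly one arrow, so one summand survives.
      rw [vertexOp_single _ rfl, Finset.sum_eq_single e]
      · rw [ghostOp_single_step _ hy, arrowOp_single _ hy]
      · intro f _ hf
        rw [ghostOp_single_of_not, map_zero]
        exact fun z hz hzy => hf (𝒳.step_inj f e z y hz hy hzy).1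
      · intro he
        exact absurd (ha.2.mem_toFinset.2 (show e ∈ emitted _ from (𝒳.proj_step e y hy).symm)) he
    · rw [vertexOp_single_of_ne _ h, eq_comm]
      refine Finset.sum_eq_zero fun e he => ?_
      rw [ghostOp_single_of_not, map_zero]
      rintro y hy rfl
      exact h ((𝒳.proj_step e y hy).trans (show e ∈ emitted a from ha.2.mem_toFinset.1 he))

variable (K) in
/-- The representation of the Leavitt path algebra on a branching system. -/
noncomputable def rep : LeavittPathAlgebra K V →ₙₐ[K] Module.End K (X →₀ K) :=
  𝒳.isLeavittFamily.lift

@[simp] theorem rep_vertex (a : V) : 𝒳.rep K (vertex K a) = 𝒳.vertexOp K a :=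
  IsLeavittFamily.lift_vertex _ a

@[simp] theorem rep_arrow (e : Quiver.Total V) : 𝒳.rep K (arrow K e) = 𝒳.arrowOp K e :=
  IsLeavittFamily.lift_arrow _ e

@[simp] theorem rep_ghost (e : Quiver.Total V) : 𝒳.rep K (ghost K e) = 𝒳.ghostOp K e :=
  IsLeavittFamily.lift_ghost _ e

end BranchingSystem

end Branching

end Leavitt

namespace Leavitt

/-! ### A one-sided ideal condition excludes bifurcations -/

section Bifurcation

open Cardinal in
-- The set `X = ℕ × Option (Quiver.Total V)` is infinite and at least as large as the set `E` of
-- arrows emitted by any vertex, so `E × X` and `X` are equinumerous when `E` is nonempty. A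
-- bijection between them cuts `X` into disjoint copies of itself, one for each emitted arrow.
theorem exists_absorbing_maps (V : Type u) [Quiver.{v} V] :
    ∃ g : V → Quiver.Total V → ℕ × Option (Quiver.Total V) → ℕ × Option (Quiver.Total V),
      (∀ a e f x y, e.left = a → f.left = a → g a e x = g a f y → e = f ∧ x = y) ∧
      ∀ a, IsRegular a → ∀ x, ∃ e y, e.left = a ∧ g a e y = x := by
  classical
  have key : ∀ a : V,
      ∃ g : Quiver.Total V → ℕ × Option (Quiver.Total V) → ℕ × Option (Quiver.Total V),
      (∀ e f x y, e.left = a → f.left = a → g e x = g f y → e = f ∧ x = y) ∧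
      (IsRegular a → ∀ x, ∃ e y, e.left = a ∧ g e y = x) := by
    intro a
    by_cases hne : (emitted a).Nonempty
    · have hinf : ℵ₀ ≤ #(ℕ × Option (Quiver.Total V)) := Cardinal.aleph0_le_mk _
      have hle : #(emitted a) ≤ #(ℕ × Option (Quiver.Total V)) :=
        ⟨⟨fun e => (0, some e.1), fun e f h => by simpa [Subtype.ext_iff] using h⟩⟩
      have hne' : #(emitted a) ≠ 0 := Cardinal.mk_ne_zero_iff.2 hne.to_subtype
      have heq : #(emitted a × (ℕ × Option (Quiver.Total V))) =
          #(ℕ × Option (Quiver.Total V)) := by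
        rw [← Cardinal.mul_def]
        exact Cardinal.mul_eq_right hinf hle hne'
      obtain ⟨φ⟩ := Cardinal.eq.1 heq
      refine ⟨fun e x => if h : e ∈ emitted a then φ (⟨e, h⟩, x) else x, ?_, ?_⟩
      · intro e f x y he hf h
        simp only [] at h
        rw [dif_pos (show e ∈ emitted a from he), dif_pos (show f ∈ emitted a from hf)] at h
        simpa [Subtype.ext_iff] using φ.injective h
      · intro _ x
        obtain ⟨⟨⟨e, he⟩, y⟩, rfl⟩ := φ.surjective x
        exact ⟨e, y, he, dif_pos he⟩
    · exact ⟨fun _ x => x, fun e f x y he => absurd ⟨e, he⟩ hne, fun h => absurd h.1 hne⟩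
  choose g hg using key
  exact ⟨g, fun a => (hg a).1, fun a => (hg a).2⟩

/-- Precomposing the injection of an arrow `e` with a permutation `τ e` of the fibre leaves its
range unchanged, so every family `τ` yields a branching system. The twists at different arrows are
independent and can be read off from the steps. -/
theorem exists_branchingSystem (V : Type u) [Quiver.{v} V] :
    ∃ F : (Quiver.Total V → Equiv.Perm (ℕ × Option (Quiver.Total V))) →
        BranchingSystem V (V × (ℕ × Option (Quiver.Total V))),
      (∀ τ x, (F τ).proj x = x.1) ∧
      (∀ τ τ' e, τ e = τ' e → (F τ).step e = (F τ').step e) ∧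
      ∀ τ τ' e x, (F τ).step e x = (F τ').step e x → τ e x.2 = τ' e x.2 := by
  obtain ⟨g, hinj, hsurj⟩ := exists_absorbing_maps V
  refine ⟨fun τ =>
    { proj := Prod.fst
      step := fun e x => (e.left, g e.left e (τ e x.2))
      proj_step := fun _ _ _ => rfl
      step_inj := ?_
      exists_step := ?_ }, fun _ _ => rfl, ?_, ?_⟩
  · rintro e f ⟨a, x⟩ ⟨b, y⟩ hx hy h
    obtain ⟨h₁, h₂⟩ := Prod.ext_iff.1 h
    simp only at h₁ h₂ hx hy
    rw [← h₁] at h₂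
    obtain ⟨rfl, h₃⟩ := hinj _ _ _ _ _ rfl h₁.symm h₂
    exact ⟨rfl, by rw [hx, hy, (τ e).injective h₃]⟩
  · rintro ⟨a, x⟩ ha
    obtain ⟨e, y, rfl, rfl⟩ := hsurj a ha x
    exact ⟨e, (e.right, (τ e).symm y), rfl, by simp⟩
  · intro τ τ' e h
    funext x
    simp only [h]
  · intro τ τ' e x h
    exact (hinj _ _ _ _ _ rfl rfl (Prod.ext_iff.1 h).2).2

variable (K : Type*) [Field K] {V : Type u} [Quiver.{v} V]

theorem pairArrow_injective {e f e' f' : Quiver.Total V} (h : pairArrow e f = pairArrow e' f') :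
    e = e' ∧ f = f' := by
  obtain ⟨a, b, e⟩ := e
  obtain ⟨c, d, f⟩ := f
  obtain ⟨a', b', e'⟩ := e'
  obtain ⟨c', d', f'⟩ := f'
  simp only [pairArrow, Quiver.Total.mk.injEq, KroneckerSquare.mk.injEq] at h
  obtain ⟨⟨rfl, rfl⟩, ⟨rfl, rfl⟩, h⟩ := h
  obtain ⟨rfl, rfl⟩ := Prod.ext_iff.1 (eq_of_heq h)
  exact ⟨rfl, rfl⟩

/-- Compare the untwisted representation with the one twisted at `[e, f]` alone. Since `e ≠ f`, no
diagonal arrow is twisted, so the two agree on the diagonal subalgebra, while `[e, f]` acts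
differently in them. -/
theorem arrow_pairArrow_notMem {e f : Quiver.Total V} (hef : e ≠ f) :
    arrow K (pairArrow e f) ∉ diagonalSubalgebra K V := by
  classical
  obtain ⟨F, hproj, hstep, hinj⟩ := exists_branchingSystem (KroneckerSquare V)
  let τ : Quiver.Total (KroneckerSquare V) →
      Equiv.Perm (ℕ × Option (Quiver.Total (KroneckerSquare V))) :=
    -- Any nontrivial permutation would do; the points `(0, none)` and `(1, none)` exist whatever
    -- the quiver.
    Function.update 1 (pairArrow e f) (Equiv.swap (0, none) (1, none))
  have hp : (F 1).proj = (F τ).proj := funext fun x => (hproj 1 x).trans (hproj τ x).symm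
  have hs : ∀ d : Quiver.Total V, (F 1).step (pairArrow d d) = (F τ).step (pairArrow d d) := by
    intro d
    apply hstep
    refine (Function.update_of_ne ?_ _ _).symm
    intro h
    obtain ⟨rfl, rfl⟩ := pairArrow_injective h
    exact hef rfl
  -- The equalizer is a subalgebra, so agreement needs checking only on generators; their operators
  -- depend only on `proj` and the steps of diagonal arrows.
  have hle : diagonalSubalgebra K V ≤ NonUnitalAlgHom.equalizer ((F 1).rep K) ((F τ).rep K) := by
    refine NonUnitalAlgebra.adjoin_le ?_
    rintro _ ((⟨a, rfl⟩ | ⟨d, rfl⟩) | ⟨d, rfl⟩)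
    · change (F 1).rep K _ = (F τ).rep K _
      rw [BranchingSystem.rep_vertex, BranchingSystem.rep_vertex]
      simp only [BranchingSystem.vertexOp, hp]
    · change (F 1).rep K _ = (F τ).rep K _
      rw [BranchingSystem.rep_arrow, BranchingSystem.rep_arrow]
      simp only [BranchingSystem.arrowOp, hp, hs]
    · change (F 1).rep K _ = (F τ).rep K _
      rw [BranchingSystem.rep_ghost, BranchingSystem.rep_ghost]
      simp only [BranchingSystem.ghostOp, hp, hs]
  intro hmem
  have heq : (F 1).rep K (arrow K (pairArrow e f)) = (F τ).rep K (arrow K (pairArrow e f)) :=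
    hle hmem
  rw [BranchingSystem.rep_arrow, BranchingSystem.rep_arrow] at heq
  have := LinearMap.congr_fun heq (Finsupp.single ((pairArrow e f).right, (0, none)) 1)
  rw [BranchingSystem.arrowOp_single _ (hproj _ _),
    BranchingSystem.arrowOp_single _ (hproj _ _)] at this
  have := hinj _ _ _ _ (Finsupp.single_left_injective one_ne_zero this)
  simp [τ] at this

/-- For arrows with common source `u`, the arrow `[e, f]` starts at the diagonal vertex `[u, u]`, so
the right ideal absorbs it. -/
theorem left_injective_of_isRightIdeal
    (hright : IsRightIdeal (diagonalSubalgebra K V).toSubmodule) {e f : Quiver.Total V}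
    (h : e.left = f.left) : e = f := by
  by_contra hef
  refine arrow_pairArrow_notMem K hef ?_
  have hv : vertex K (⟨e.left, e.left⟩ : KroneckerSquare V) ∈ diagonalSubalgebra K V :=
    NonUnitalAlgebra.subset_adjoin K (.inl (.inl ⟨e.left, rfl⟩))
  have := hright (arrow K (pairArrow e f)) _ hv
  rwa [show (⟨e.left, e.left⟩ : KroneckerSquare V) = (pairArrow e f).left by
    simp [pairArrow, h], left_mul_arrow] at this

end Bifurcation

/-! ### Monomials span the algebra -/

section Paths

variable {K : Type*} [Field K] {V : Type u} [Quiver.{v} V]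

theorem vertex_mul_pathElt {a b : V} (p : Quiver.Path a b) :
    vertex K a * pathElt K p = pathElt K p := by
  induction p with
  | nil => exact vertex_mul_self a
  | cons p e ih => rw [pathElt, ← mul_assoc, ih]

theorem pathElt_mul_vertex {a b : V} (p : Quiver.Path a b) :
    pathElt K p * vertex K b = pathElt K p := by
  cases p with
  | nil => exact vertex_mul_self a
  | cons p e => rw [pathElt, mul_assoc, arrow_mul_right ⟨_, _, e⟩]

theorem ghostPathElt_mul_vertex {a b : V} (p : Quiver.Path a b) :
    ghostPathElt K p * vertex K a = ghostPathElt K p := by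
  induction p with
  | nil => exact vertex_mul_self a
  | cons p e ih => rw [ghostPathElt, mul_assoc, ih]

theorem vertex_mul_ghostPathElt {a b : V} (p : Quiver.Path a b) :
    vertex K b * ghostPathElt K p = ghostPathElt K p := by
  cases p with
  | nil => exact vertex_mul_self a
  | cons p e => rw [ghostPathElt, ← mul_assoc, right_mul_ghost ⟨_, _, e⟩]

theorem pathElt_comp {a b c : V} (p : Quiver.Path a b) (q : Quiver.Path b c) :
    pathElt K (p.comp q) = pathElt K p * pathElt K q := by
  induction q with
  | nil => exact (pathElt_mul_vertex p).symm
  | cons q e ih => rw [Quiver.Path.comp_cons, pathElt, pathElt, ih, mul_assoc]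

theorem ghostPathElt_comp {a b c : V} (p : Quiver.Path a b) (q : Quiver.Path b c) :
    ghostPathElt K (p.comp q) = ghostPathElt K q * ghostPathElt K p := by
  induction q with
  | nil => exact (vertex_mul_ghostPathElt p).symm
  | cons q e ih => rw [Quiver.Path.comp_cons, ghostPathElt, ghostPathElt, ih, mul_assoc]

theorem pathElt_toPath {a b : V} (e : a ⟶ b) :
    pathElt K e.toPath = arrow K ⟨a, b, e⟩ :=
  left_mul_arrow ⟨a, b, e⟩

theorem ghostPathElt_mul_pathElt_self {a b : V} (p : Quiver.Path a b) :
    ghostPathElt K p * pathElt K p = vertex K b := by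
  induction p with
  | nil => exact vertex_mul_self a
  | cons p e ih =>
    rw [ghostPathElt, pathElt, mul_assoc, ← mul_assoc (ghostPathElt K p), ih, ← mul_assoc,
      ghost_mul_left ⟨_, _, e⟩, ghost_mul_arrow_self]

/-- The element `α β*`. -/
noncomputable def monomial (K : Type*) [Field K] {V : Type u} [Quiver.{v} V] {a b c : V}
    (α : Quiver.Path a c) (β : Quiver.Path b c) : LeavittPathAlgebra K V :=
  pathElt K α * ghostPathElt K β

theorem monomial_mem_component {a b c : V} (α : Quiver.Path a c) (β : Quiver.Path b c) :
    monomial K α β ∈ component K V ((α.length : ℤ) - β.length) :=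
  Submodule.subset_span ⟨a, b, c, α, β, rfl, rfl⟩

theorem vertex_mul_monomial {a b c : V} (α : Quiver.Path a c) (β : Quiver.Path b c) :
    vertex K a * monomial K α β = monomial K α β := by
  rw [monomial, ← mul_assoc, vertex_mul_pathElt]

theorem vertex_mul_monomial_of_ne {a b c d : V} (h : d ≠ a) (α : Quiver.Path a c)
    (β : Quiver.Path b c) : vertex K d * monomial K α β = 0 := by
  rw [← vertex_mul_monomial, ← mul_assoc, vertex_mul_of_ne h, zero_mul]

theorem monomial_mul_vertex {a b c : V} (α : Quiver.Path a c) (β : Quiver.Path b c) :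
    monomial K α β * vertex K b = monomial K α β := by
  rw [monomial, mul_assoc, ghostPathElt_mul_vertex]

theorem monomial_mul_vertex_of_ne {a b c d : V} (h : b ≠ d) (α : Quiver.Path a c)
    (β : Quiver.Path b c) : monomial K α β * vertex K d = 0 := by
  rw [← monomial_mul_vertex, mul_assoc, vertex_mul_of_ne h, mul_zero]

theorem monomial_nil (a : V) :
    monomial K (Quiver.Path.nil : Quiver.Path a a) .nil = vertex K a :=
  vertex_mul_self a

theorem component_induction {n : ℤ} {P : LeavittPathAlgebra K V → Prop}
    (hmon : ∀ (a b c : V) (α : Quiver.Path a c) (β : Quiver.Path b c),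
      (α.length : ℤ) - β.length = n → P (monomial K α β))
    (hzero : P 0) (hadd : ∀ x y, P x → P y → P (x + y)) (hsmul : ∀ (k : K) x, P x → P (k • x))
    {x : LeavittPathAlgebra K V} (hx : x ∈ component K V n) : P x := by
  refine Submodule.span_induction (p := fun x _ => P x) ?_ hzero (fun x y _ _ => hadd x y)
    (fun k x _ => hsmul k x) hx
  rintro _ ⟨a, b, c, α, β, h, rfl⟩
  exact hmon a b c α β h

theorem arrow_mul_monomial_mem (e : Quiver.Total V) {a b c : V} (α : Quiver.Path a c)
    (β : Quiver.Path b c) : arrow K e * monomial K α β ∈ ⨆ n, component K V n := by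
  by_cases h : e.right = a
  · subst h
    have : arrow K e * monomial K α β = monomial K (e.hom.toPath.comp α) β := by
      rw [monomial, monomial, pathElt_comp, pathElt_toPath, mul_assoc]
    rw [this]
    exact Submodule.mem_iSup_of_mem _ (monomial_mem_component _ _)
  · rw [← arrow_mul_right, mul_assoc, vertex_mul_monomial_of_ne h, mul_zero]
    exact zero_mem _

/-- If `α` is trivial, `e*` lengthens `β`; otherwise it cancels the first arrow of `α` or
annihilates the product. -/
theorem ghost_mul_monomial_mem (e : Quiver.Total V) {a b c : V} (α : Quiver.Path a c)
    (β : Quiver.Path b c) : ghost K e * monomial K α β ∈ ⨆ n, component K V n := by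
  by_cases h : e.left = a
  · subst h
    by_cases h0 : α.length = 0
    · obtain rfl := Quiver.Path.eq_of_length_zero α h0
      obtain rfl := Quiver.Path.eq_nil_of_length_zero α h0
      have : ghost K e * monomial K .nil β = monomial K .nil (β.cons e.hom) := by
        rw [monomial, monomial, ghostPathElt, pathElt, pathElt, vertex_mul_ghostPathElt,
          ← mul_assoc]
        exact congrArg (· * _) (right_mul_ghost e).symm
      rw [this]
      exact Submodule.mem_iSup_of_mem _ (monomial_mem_component _ _)
    · obtain ⟨n, hn⟩ := Nat.exists_eq_succ_of_ne_zero h0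
      -- Paths are built by appending at the end, so the first arrow has to be split off separately.
      obtain ⟨d, f, q, -, rfl⟩ := α.eq_toPath_comp_of_length_eq_succ hn
      rw [monomial, pathElt_comp, pathElt_toPath, mul_assoc, ← mul_assoc]
      by_cases hf : e = ⟨_, _, f⟩
      · rw [← hf, ghost_mul_arrow_self, hf, ← mul_assoc, vertex_mul_pathElt]
        exact Submodule.mem_iSup_of_mem _ (monomial_mem_component q β)
      · rw [ghost_mul_arrow_of_ne hf, zero_mul]
        exact zero_mem _
  · rw [← ghost_mul_left, mul_assoc, vertex_mul_monomial_of_ne h, mul_zero]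
    exact zero_mem _

theorem vertex_mul_monomial_mem (d : V) {a b c : V} (α : Quiver.Path a c)
    (β : Quiver.Path b c) : vertex K d * monomial K α β ∈ ⨆ n, component K V n := by
  by_cases h : d = a
  · rw [h, vertex_mul_monomial]
    exact Submodule.mem_iSup_of_mem _ (monomial_mem_component _ _)
  · rw [vertex_mul_monomial_of_ne h]
    exact zero_mem _

/-- Left multiplication by each generator preserves the span of the monomials, so this span is a
left ideal. -/
theorem mul_mem_iSup_component (x : LeavittPathAlgebra K V) {y : LeavittPathAlgebra K V}
    (hy : y ∈ ⨆ n, component K V n) : x * y ∈ ⨆ n, component K V n := by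
  have aux : ∀ x : LeavittPathAlgebra K V,
      (∀ (a b c : V) (α : Quiver.Path a c) (β : Quiver.Path b c),
        x * monomial K α β ∈ ⨆ n, component K V n) →
      ∀ y ∈ ⨆ n, component K V n, x * y ∈ ⨆ n, component K V n := by
    intro x hx y hy
    refine Submodule.iSup_induction (motive := fun y => x * y ∈ ⨆ n, component K V n)
      _ hy (fun n y hy => ?_) ?_ ?_
    · refine component_induction (P := fun y => x * y ∈ ⨆ n, component K V n)
        (fun a b c α β _ => hx a b c α β) ?_ ?_ ?_ hy
      · rw [mul_zero]; exact zero_mem _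
      · intro y z hy hz; rw [mul_add]; exact add_mem hy hz
      · intro k y hy; rw [mul_smul_comm]; exact Submodule.smul_mem _ k hy
    · rw [mul_zero]; exact zero_mem _
    · intro y z hy hz; rw [mul_add]; exact add_mem hy hz
  induction x using LeavittPathAlgebra.induction generalizing y with
  | hv d => exact aux _ (fun _ _ _ => vertex_mul_monomial_mem d) _ hy
  | ha e => exact aux _ (fun _ _ _ => arrow_mul_monomial_mem e) _ hy
  | hg e => exact aux _ (fun _ _ _ => ghost_mul_monomial_mem e) _ hy
  | hzero => rw [zero_mul]; exact zero_mem _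
  | hadd x z hx hz => rw [add_mul]; exact add_mem (hx hy) (hz hy)
  | hmul x z hx hz => rw [mul_assoc]; exact hx (hz hy)
  | hsmul k x hx => rw [smul_mul_assoc]; exact Submodule.smul_mem _ k (hx hy)

variable (K V) in
theorem iSup_component : ⨆ n, component K V n = ⊤ := by
  refine eq_top_iff.2 fun x _ => ?_
  induction x using LeavittPathAlgebra.induction with
  | hv a =>
    rw [← monomial_nil]
    exact Submodule.mem_iSup_of_mem _ (monomial_mem_component _ _)
  | ha e =>
    rw [← arrow_mul_right, ← monomial_nil]
    exact arrow_mul_monomial_mem e _ _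
  | hg e =>
    rw [← ghost_mul_left, ← monomial_nil]
    exact ghost_mul_monomial_mem e _ _
  | hzero => exact zero_mem _
  | hadd x y hx hy => exact add_mem (hx trivial) (hy trivial)
  | hmul x y _ hy => exact mul_mem_iSup_component x (hy trivial)
  | hsmul k x hx => exact Submodule.smul_mem _ k (hx trivial)

theorem monomial_induction {P : LeavittPathAlgebra K V → Prop}
    (hmon : ∀ (a b c : V) (α : Quiver.Path a c) (β : Quiver.Path b c), P (monomial K α β))
    (hzero : P 0) (hadd : ∀ x y, P x → P y → P (x + y)) (hsmul : ∀ (k : K) x, P x → P (k • x))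
    (x : LeavittPathAlgebra K V) : P x :=
  Submodule.iSup_induction (motive := P) _ (iSup_component K V ▸ Submodule.mem_top : x ∈ _)
    (fun _ _ hx => component_induction (fun a b c α β _ => hmon a b c α β) hzero hadd hsmul hx)
    hzero hadd

end Paths

end Leavitt

/-! ### Quivers without bifurcations -/

namespace Leavitt

/-- Every vertex emits at most one arrow. -/
def NoBifurcations (V : Type u) [Quiver.{v} V] : Prop :=
  ∀ e f : Quiver.Total V, e.left = f.left → e = f

section NoBifurcations

variable {V : Type u} [Quiver.{v} V]

theorem NoBifurcations.not_isBifurcation (hV : NoBifurcations V) (a : V) :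
    ¬ IsBifurcation a := by
  rintro ⟨e, he, f, hf, hef⟩
  exact hef (hV e f (Eq.trans he (Eq.symm hf)))

/-- Each next arrow is forced, so of two paths from the same vertex the shorter is a prefix of the
longer. -/
theorem NoBifurcations.exists_eq_comp (hV : NoBifurcations V) {a b c : V}
    (p : Quiver.Path a b) (q : Quiver.Path a c) (h : q.length ≤ p.length) :
    ∃ r : Quiver.Path c b, p = q.comp r := by
  induction p generalizing c with
  | nil =>
    have h0 : q.length = 0 := Nat.le_zero.1 h
    obtain rfl := Quiver.Path.eq_of_length_zero q h0
    exact ⟨.nil, by rw [Quiver.Path.eq_nil_of_length_zero q h0]; rfl⟩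
  | @cons x b p e ih =>
    by_cases hlt : q.length ≤ p.length
    · obtain ⟨r, rfl⟩ := ih q hlt
      exact ⟨r.cons e, rfl⟩
    · cases q with
      | nil => exact absurd (Nat.zero_le _) hlt
      | @cons y _ q f =>
        rw [Quiver.Path.length_cons, Quiver.Path.length_cons] at h
        rw [Quiver.Path.length_cons] at hlt
        -- Here the two paths have the same length. Their truncations coincide, and then the last
        -- arrows leave the same vertex.
        obtain ⟨r, hr⟩ := ih q (by omega)
        have hr0 : r.length = 0 := by
          have := congrArg Quiver.Path.length hr
          rw [Quiver.Path.length_comp] at this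
          omega
        obtain rfl := Quiver.Path.eq_of_length_zero r hr0
        rw [Quiver.Path.eq_nil_of_length_zero r hr0, Quiver.Path.comp_nil] at hr
        subst hr
        have := hV ⟨_, _, e⟩ ⟨_, _, f⟩ rfl
        simp only [Quiver.Total.mk.injEq, true_and] at this
        obtain ⟨rfl, hef⟩ := this
        rw [heq_eq_eq] at hef
        exact ⟨.nil, by rw [hef]; rfl⟩

theorem NoBifurcations.eq_of_length_eq (hV : NoBifurcations V) {a b : V}
    (p q : Quiver.Path a b) (h : p.length = q.length) : p = q := by
  obtain ⟨r, rfl⟩ := hV.exists_eq_comp p q h.ge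
  rw [Quiver.Path.eq_nil_of_length_zero r (by rw [Quiver.Path.length_comp] at h; omega),
    Quiver.Path.comp_nil]

theorem NoBifurcations.right_eq_of_length_eq (hV : NoBifurcations V) {a b c : V}
    (p : Quiver.Path a b) (q : Quiver.Path a c) (h : p.length = q.length) : b = c := by
  obtain ⟨r, rfl⟩ := hV.exists_eq_comp p q h.ge
  exact (Quiver.Path.eq_of_length_zero r (by rw [Quiver.Path.length_comp] at h; omega)).symm

/-- A path at least as long as `p c` begins with `p c`, and cutting out `c` shortens it without
moving its end. Hence lengths below `|p| + |c|` suffice, and each length leads to at most one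
vertex. -/
theorem NoBifurcations.finite_tree (hV : NoBifurcations V) {a w : V} (p : Quiver.Path a w)
    (c : Quiver.Path w w) (hc : 0 < c.length) : (tree a).Finite := by
  have hred : ∀ n, ∀ x, ∀ q : Quiver.Path a x, q.length = n →
      ∃ q' : Quiver.Path a x, q'.length < p.length + c.length := by
    intro n
    induction n using Nat.strong_induction_on with
    | _ n ih =>
      intro x q hq
      by_cases hn : n < p.length + c.length
      · exact ⟨q, hq ▸ hn⟩
      · obtain ⟨r, rfl⟩ := hV.exists_eq_comp q (p.comp c) (by rw [Quiver.Path.length_comp]; omega)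
        rw [Quiver.Path.length_comp, Quiver.Path.length_comp] at hq
        exact ih (p.comp r).length (by rw [Quiver.Path.length_comp]; omega) x (p.comp r) rfl
  refine ((Set.finite_lt_nat (p.length + c.length)).biUnion
    (t := fun n => {x | ∃ q : Quiver.Path a x, q.length = n}) fun n _ => ?_).subset ?_
  · refine Set.Subsingleton.finite ?_
    rintro x ⟨q, hq⟩ y ⟨q', hq'⟩
    exact hV.right_eq_of_length_eq q q' (hq.trans hq'.symm)
  · rintro x ⟨q⟩
    obtain ⟨q', hq'⟩ := hred _ x q rfl
    exact Set.mem_biUnion (show q'.length ∈ {n | n < p.length + c.length} from hq') ⟨q', rfl⟩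

theorem NoBifurcations.isRayPoint_or_isLaurentVertex (hV : NoBifurcations V) (a : V) :
    IsRayPoint a ∨ IsLaurentVertex a := by
  by_cases h : ∃ w ∈ tree a, ∃ c : Quiver.Path w w, IsCycle c
  · obtain ⟨w, ⟨p⟩, c, hc⟩ := h
    refine .inr ⟨hV.finite_tree p c hc.1, fun x _ => hV.not_isBifurcation x, w, ⟨p⟩, c, hc, ?_⟩
    rintro ⟨e, -, f, hf, hfe⟩
    exact hfe (hV f e hf)
  · exact .inl fun w hw => ⟨hV.not_isBifurcation w, fun c hc => h ⟨w, hw, c, hc⟩⟩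

theorem NoBifurcations.kroneckerSquare (hV : NoBifurcations V) :
    NoBifurcations (KroneckerSquare V) := by
  rintro ⟨⟨a, b⟩, ⟨c, d⟩, e, f⟩ ⟨⟨a', b'⟩, ⟨c', d'⟩, e', f'⟩ h
  simp only [KroneckerSquare.mk.injEq] at h
  obtain ⟨rfl, rfl⟩ := h
  have h₁ := hV ⟨a, c, e⟩ ⟨a, c', e'⟩ rfl
  have h₂ := hV ⟨b, d, f⟩ ⟨b, d', f'⟩ rfl
  simp only [Quiver.Total.mk.injEq, true_and] at h₁ h₂
  obtain ⟨rfl, h₁⟩ := h₁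
  obtain ⟨rfl, h₂⟩ := h₂
  obtain rfl := eq_of_heq h₁
  obtain rfl := eq_of_heq h₂
  rfl

/-- The branching system on `V × ℤ`. -/
def NoBifurcations.branchingSystem (hV : NoBifurcations V) : BranchingSystem V (V × ℤ) where
  proj := Prod.fst
  -- The integer coordinate counts arrows, so an element of degree `n` raises it by `n`.
  step e x := (e.left, x.2 + 1)
  proj_step _ _ _ := rfl
  step_inj := by
    rintro e f ⟨a, m⟩ ⟨b, n⟩ ha hb h
    obtain ⟨h₁, h₂⟩ := Prod.ext_iff.1 h
    obtain rfl := hV e f h₁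
    exact ⟨rfl, Prod.ext (Eq.trans ha (Eq.symm hb)) (by simpa using h₂)⟩
  exists_step := by
    rintro ⟨a, m⟩ ⟨⟨e, he⟩, -⟩
    exact ⟨e, (e.right, m - 1), rfl, Prod.ext he (by simp)⟩

variable {K : Type*} [Field K]

/-- The source of `e` emits only `e`, so its Cuntz-Krieger sum has a single term. -/
theorem NoBifurcations.arrow_mul_ghost (hV : NoBifurcations V) (e : Quiver.Total V) :
    arrow K e * ghost K e = vertex K e.left := by
  have hem : emitted e.left = {e} := Set.eq_singleton_iff_unique_mem.2 ⟨rfl, fun f hf => hV f e hf⟩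
  have hreg : IsRegular e.left := ⟨⟨e, rfl⟩, by rw [hem]; exact Set.finite_singleton e⟩
  rw [cuntz_krieger _ hreg, Finset.sum_eq_single e]
  · exact fun f hf hfe => absurd (hV f e (show f ∈ emitted e.left from hreg.2.mem_toFinset.1 hf)) hfe
  · exact fun h => absurd (hreg.2.mem_toFinset.2 (show e ∈ emitted e.left from rfl)) h

theorem NoBifurcations.pathElt_mul_ghostPathElt (hV : NoBifurcations V) {a b : V}
    (p : Quiver.Path a b) : pathElt K p * ghostPathElt K p = vertex K a := by
  induction p with
  | nil => exact vertex_mul_self a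
  | cons p e ih =>
    rw [pathElt, ghostPathElt, mul_assoc, ← mul_assoc (arrow K _), hV.arrow_mul_ghost,
      vertex_mul_ghostPathElt, ih]

theorem NoBifurcations.monomial_mul_monomial (hV : NoBifurcations V) {a b c : V}
    (α : Quiver.Path a c) (β : Quiver.Path b c) :
    monomial K α β * monomial K β α = vertex K a := by
  rw [monomial, monomial, mul_assoc, ← mul_assoc (ghostPathElt K β),
    ghostPathElt_mul_pathElt_self, vertex_mul_ghostPathElt, hV.pathElt_mul_ghostPathElt]

theorem NoBifurcations.monomial_comp (hV : NoBifurcations V) {a b c d : V}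
    (α : Quiver.Path a c) (β : Quiver.Path b c) (γ : Quiver.Path c d) :
    monomial K (α.comp γ) (β.comp γ) = monomial K α β := by
  rw [monomial, monomial, pathElt_comp, ghostPathElt_comp, mul_assoc,
    ← mul_assoc (pathElt K γ), hV.pathElt_mul_ghostPathElt, vertex_mul_ghostPathElt]

/-- The longer pair extends the shorter one by `γ` and `γ'`. Equality of degrees forces these to
have the same length, hence to be the same path, and `γ γ*` cancels. -/
theorem NoBifurcations.monomial_eq (hV : NoBifurcations V) {a b c d : V}
    (α : Quiver.Path a c) (β : Quiver.Path b c) (α' : Quiver.Path a d) (β' : Quiver.Path b d)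
    (h : (α.length : ℤ) - β.length = (α'.length : ℤ) - β'.length) :
    monomial K α β = monomial K α' β' := by
  wlog hle : α.length ≤ α'.length generalizing c d
  · exact (this α' β' α β h.symm (by omega)).symm
  obtain ⟨γ, rfl⟩ := hV.exists_eq_comp α' α hle
  obtain ⟨γ', rfl⟩ := hV.exists_eq_comp β' β (by omega)
  rw [Quiver.Path.length_comp, Quiver.Path.length_comp] at h
  rw [hV.eq_of_length_eq γ' γ (by push_cast at h; omega), hV.monomial_comp]

theorem NoBifurcations.rep_pathElt (hV : NoBifurcations V) {a b : V} (p : Quiver.Path a b)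
    (m : ℤ) : hV.branchingSystem.rep K (pathElt K p) (Finsupp.single (b, m) 1) =
      Finsupp.single (a, m + p.length) 1 := by
  induction p generalizing m with
  | nil =>
    rw [pathElt, BranchingSystem.rep_vertex, BranchingSystem.vertexOp_single _ (x := (a, m)) (a := a) rfl]
    simp
  | cons p e ih =>
    rw [pathElt, map_mul, Module.End.mul_apply, BranchingSystem.rep_arrow,
      BranchingSystem.arrowOp_single _ rfl]
    refine (ih (m + 1)).trans ?_
    rw [Quiver.Path.length_cons]
    push_cast
    ring_nf

theorem NoBifurcations.rep_ghostPathElt (hV : NoBifurcations V) {a b : V} (p : Quiver.Path a b)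
    (m : ℤ) : hV.branchingSystem.rep K (ghostPathElt K p) (Finsupp.single (a, m) 1) =
      Finsupp.single (b, m - p.length) 1 := by
  -- The basis vector is written as the image of `(b, m - |p|)` under `p`, which the ghost path then
  -- undoes.
  conv_lhs => rw [← sub_add_cancel m (p.length : ℤ), ← hV.rep_pathElt (K := K) p]
  rw [← Module.End.mul_apply, ← map_mul, ghostPathElt_mul_pathElt_self,
    BranchingSystem.rep_vertex, BranchingSystem.vertexOp_single _ (x := (b, m - p.length)) (a := b) rfl]

theorem NoBifurcations.rep_monomial (hV : NoBifurcations V) {a b c : V} (α : Quiver.Path a c)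
    (β : Quiver.Path b c) (m : ℤ) :
    hV.branchingSystem.rep K (monomial K α β) (Finsupp.single (b, m) 1) =
      Finsupp.single (a, m + (α.length - β.length)) 1 := by
  rw [monomial, map_mul, Module.End.mul_apply, hV.rep_ghostPathElt, hV.rep_pathElt]
  ring_nf

variable (K) in
/-- The coefficient at the monomials of degree `n` that lead from `a` to `b`. -/
noncomputable def NoBifurcations.coeff (hV : NoBifurcations V) (a b : V) (n : ℤ) :
    LeavittPathAlgebra K V →ₗ[K] K :=
  Finsupp.lapply (a, n) ∘ₗ LinearMap.applyₗ (Finsupp.single (b, (0 : ℤ)) (1 : K)) ∘ₗ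
    (hV.branchingSystem.rep K : LeavittPathAlgebra K V →ₗ[K] _)

theorem NoBifurcations.coeff_apply (hV : NoBifurcations V) (a b : V) (n : ℤ)
    (x : LeavittPathAlgebra K V) : hV.coeff K a b n x =
      hV.branchingSystem.rep K x (Finsupp.single (b, 0) 1) (a, n) := rfl

theorem NoBifurcations.coeff_vertex_mul_self (hV : NoBifurcations V) (a b : V) (n : ℤ)
    (x : LeavittPathAlgebra K V) :
    hV.coeff K a b n (x * vertex K b) = hV.coeff K a b n x := by
  rw [coeff_apply, coeff_apply, map_mul, Module.End.mul_apply, BranchingSystem.rep_vertex,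
    BranchingSystem.vertexOp_single _ (x := (b, (0 : ℤ))) (a := b) rfl]

open Classical in
theorem NoBifurcations.coeff_monomial (hV : NoBifurcations V) (a b : V) (n : ℤ) {a' b' c : V}
    (α : Quiver.Path a' c) (β : Quiver.Path b' c) :
    hV.coeff K a b n (monomial K α β) =
      if a' = a ∧ b' = b ∧ (α.length : ℤ) - β.length = n then 1 else 0 := by
  by_cases hb : b' = b
  · subst hb
    rw [coeff_apply, hV.rep_monomial, Finsupp.single_apply]
    simp
  · rw [← hV.coeff_vertex_mul_self, monomial_mul_vertex_of_ne hb, map_zero,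
      if_neg fun h => hb h.2.1]

theorem NoBifurcations.coeff_of_mem_component (hV : NoBifurcations V) {a b : V} {m n : ℤ}
    (h : m ≠ n) {x : LeavittPathAlgebra K V} (hx : x ∈ component K V m) :
    hV.coeff K a b n x = 0 := by
  refine component_induction (P := fun x => hV.coeff K a b n x = 0) ?_ (map_zero _) ?_ ?_ hx
  · rintro a' b' c α β rfl
    rw [hV.coeff_monomial, if_neg fun h' => h h'.2.2]
  · intro x y hx hy
    rw [map_add, hx, hy, add_zero]
  · intro k x hx
    rw [map_smul, hx, smul_zero]

/-- In a single degree, the corner at two vertices is at most one-dimensional. -/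
theorem NoBifurcations.vertex_mul_mul_vertex (hV : NoBifurcations V) (a b : V) {n : ℤ}
    {x : LeavittPathAlgebra K V} (hx : x ∈ component K V n) :
    vertex K a * x * vertex K b = 0 ∨ ∃ (c : V) (α : Quiver.Path a c) (β : Quiver.Path b c),
      (α.length : ℤ) - β.length = n ∧
        vertex K a * x * vertex K b = hV.coeff K a b n x • monomial K α β := by
  -- If some monomial of degree `n` joins the two vertices, all of them are equal to it; if none
  -- does, the corner vanishes in this degree.
  by_cases hex : ∃ (c : V) (α : Quiver.Path a c) (β : Quiver.Path b c),
      (α.length : ℤ) - β.length = n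
  · right
    obtain ⟨c, α, β, h⟩ := hex
    refine ⟨c, α, β, h, ?_⟩
    refine component_induction (P := fun x => vertex K a * x * vertex K b =
      hV.coeff K a b n x • monomial K α β) ?_ ?_ ?_ ?_ hx
    · intro a' b' c' α' β' h'
      rw [hV.coeff_monomial]
      split_ifs with heq
      · obtain ⟨rfl, rfl, -⟩ := heq
        rw [vertex_mul_monomial, monomial_mul_vertex, one_smul,
          hV.monomial_eq α' β' α β (h'.trans h.symm)]
      · rw [zero_smul]
        by_cases ha : a' = a
        · by_cases hb : b' = b
          · exact absurd ⟨ha, hb, h'⟩ heq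
          · rw [mul_assoc, monomial_mul_vertex_of_ne hb, mul_zero]
        · rw [vertex_mul_monomial_of_ne (Ne.symm ha), zero_mul]
    · rw [mul_zero, zero_mul, map_zero, zero_smul]
    · intro x y hx hy
      rw [mul_add, add_mul, hx, hy, map_add, add_smul]
    · intro k x hx
      rw [mul_smul_comm, smul_mul_assoc, hx, map_smul, smul_assoc]
  · left
    refine component_induction (P := fun x => vertex K a * x * vertex K b = 0) ?_ ?_ ?_ ?_ hx
    · intro a' b' c' α' β' h'
      by_cases ha : a = a'
      · by_cases hb : b' = b
        · subst ha hb
          exact absurd ⟨c', α', β', h'⟩ hex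
        · rw [mul_assoc, monomial_mul_vertex_of_ne hb, mul_zero]
      · rw [vertex_mul_monomial_of_ne ha, zero_mul]
    · rw [mul_zero, zero_mul]
    · intro x y hx hy
      rw [mul_add, add_mul, hx, hy, add_zero]
    · intro k x hx
      rw [mul_smul_comm, smul_mul_assoc, hx, smul_zero]

end NoBifurcations

/-! ### Vertices as orthogonal local units -/

section LocalUnits

variable (K : Type*) [Field K] {V : Type u} [Quiver.{v} V]

/-- The left ideal generated by the vertex `a`. -/
noncomputable def leftCorner (a : V) : Submodule K (LeavittPathAlgebra K V) where
  carrier := {x | x * vertex K a = x}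
  zero_mem' := zero_mul _
  add_mem' {x y} (hx : _ = _) (hy : _ = _) := show _ = _ by rw [add_mul, hx, hy]
  smul_mem' k x (hx : _ = _) := show _ = _ by rw [smul_mul_assoc, hx]

/-- The right ideal generated by the vertex `a`. -/
noncomputable def rightCorner (a : V) : Submodule K (LeavittPathAlgebra K V) where
  carrier := {x | vertex K a * x = x}
  zero_mem' := mul_zero _
  add_mem' {x y} (hx : _ = _) (hy : _ = _) := show _ = _ by rw [mul_add, hx, hy]
  smul_mem' k x (hx : _ = _) := show _ = _ by rw [mul_smul_comm, hx]

variable {K}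

theorem mem_leftCorner {a : V} {x : LeavittPathAlgebra K V} :
    x ∈ leftCorner K a ↔ x * vertex K a = x := Iff.rfl

theorem mem_rightCorner {a : V} {x : LeavittPathAlgebra K V} :
    x ∈ rightCorner K a ↔ vertex K a * x = x := Iff.rfl

theorem monomial_mem_leftCorner {a b c : V} (α : Quiver.Path a c) (β : Quiver.Path b c) :
    monomial K α β ∈ leftCorner K b := monomial_mul_vertex α β

theorem monomial_mem_rightCorner {a b c : V} (α : Quiver.Path a c) (β : Quiver.Path b c) :
    monomial K α β ∈ rightCorner K a := vertex_mul_monomial α β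

theorem mul_vertex_eq_zero_of_mem {s : Set V} {b : V} (hb : b ∉ s) {x : LeavittPathAlgebra K V}
    (hx : x ∈ ⨆ a ∈ s, leftCorner K a) : x * vertex K b = 0 := by
  have hle : ⨆ a ∈ s, leftCorner K a ≤ LinearMap.ker (LinearMap.mulRight K (vertex K b)) := by
    refine iSup₂_le fun a ha x hx => ?_
    rw [LinearMap.mem_ker, LinearMap.mulRight_apply, ← mem_leftCorner.1 hx, mul_assoc,
      vertex_mul_of_ne (by rintro rfl; exact hb ha), mul_zero]
  exact hle hx

theorem vertex_mul_eq_zero_of_mem {s : Set V} {b : V} (hb : b ∉ s) {x : LeavittPathAlgebra K V}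
    (hx : x ∈ ⨆ a ∈ s, rightCorner K a) : vertex K b * x = 0 := by
  have hle : ⨆ a ∈ s, rightCorner K a ≤ LinearMap.ker (LinearMap.mulLeft K (vertex K b)) := by
    refine iSup₂_le fun a ha x hx => ?_
    rw [LinearMap.mem_ker, LinearMap.mulLeft_apply, ← mem_rightCorner.1 hx, ← mul_assoc,
      vertex_mul_of_ne (by rintro rfl; exact hb ha), zero_mul]
  exact hle hx

variable (K V) in
theorem iSup_leftCorner : ⨆ a : V, leftCorner K a = ⊤ :=
  eq_top_iff.2 fun x _ => monomial_induction (P := fun x => x ∈ ⨆ a : V, leftCorner K a)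
    (fun _ b _ α β => Submodule.mem_iSup_of_mem b (monomial_mem_leftCorner α β)) (zero_mem _)
    (fun _ _ => add_mem) (fun k _ => Submodule.smul_mem _ k) x

variable (K V) in
theorem iSup_rightCorner : ⨆ a : V, rightCorner K a = ⊤ :=
  eq_top_iff.2 fun x _ => monomial_induction (P := fun x => x ∈ ⨆ a : V, rightCorner K a)
    (fun a _ _ α β => Submodule.mem_iSup_of_mem a (monomial_mem_rightCorner α β)) (zero_mem _)
    (fun _ _ => add_mem) (fun k _ => Submodule.smul_mem _ k) x

/-- Every element is a finite sum of elements of left corners, and right multiplication by `a` picks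
out the summand at `a`. -/
theorem eq_zero_of_mul_vertex {x : LeavittPathAlgebra K V} (h : ∀ a, x * vertex K a = 0) :
    x = 0 := by
  obtain ⟨f, hf, rfl⟩ := (Submodule.mem_iSup_iff_exists_finsupp (fun a : V => leftCorner K a) x).1
    (iSup_leftCorner K V ▸ Submodule.mem_top)
  refine Finset.sum_eq_zero fun a _ => ?_
  have := h a
  rw [Finsupp.sum, Finset.sum_mul, Finset.sum_eq_single a] at this
  · exact (mem_leftCorner.1 (hf a)).symm.trans this
  · intro b _ hb
    rw [← mem_leftCorner.1 (hf b), mul_assoc, vertex_mul_of_ne hb, mul_zero]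
  · intro ha
    rw [Finsupp.notMem_support_iff.1 ha, zero_mul]

theorem eq_zero_of_vertex_mul {x : LeavittPathAlgebra K V} (h : ∀ a, vertex K a * x = 0) :
    x = 0 := by
  obtain ⟨f, hf, rfl⟩ := (Submodule.mem_iSup_iff_exists_finsupp (fun a : V => rightCorner K a) x).1
    (iSup_rightCorner K V ▸ Submodule.mem_top)
  refine Finset.sum_eq_zero fun a _ => ?_
  have := h a
  rw [Finsupp.sum, Finset.mul_sum, Finset.sum_eq_single a] at this
  · exact (mem_rightCorner.1 (hf a)).symm.trans this
  · intro b _ hb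
    rw [← mem_rightCorner.1 (hf b), ← mul_assoc, vertex_mul_of_ne hb.symm, zero_mul]
  · intro ha
    rw [Finsupp.notMem_support_iff.1 ha, mul_zero]

end LocalUnits

end Leavitt

namespace Leavitt

/-! ### Coefficients determine elements and their degrees -/

section Coefficients

variable {K : Type*} [Field K] {V : Type u} [Quiver.{v} V]

theorem exists_homogeneous_decomposition (x : LeavittPathAlgebra K V) :
    ∃ f : ℤ →₀ LeavittPathAlgebra K V, (∀ n, f n ∈ component K V n) ∧
      (f.sum fun _ y => y) = x :=
  (Submodule.mem_iSup_iff_exists_finsupp (component K V) x).1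
    (iSup_component K V ▸ Submodule.mem_top)

theorem NoBifurcations.coeff_sum (hV : NoBifurcations V) {f : ℤ →₀ LeavittPathAlgebra K V}
    (hf : ∀ n, f n ∈ component K V n) (a b : V) (n : ℤ) :
    hV.coeff K a b n (f.sum fun _ y => y) = hV.coeff K a b n (f n) := by
  rw [Finsupp.sum, map_sum, Finset.sum_eq_single n]
  · exact fun m _ hm => hV.coeff_of_mem_component hm (hf m)
  · intro hn
    rw [Finsupp.notMem_support_iff.1 hn, map_zero]

theorem NoBifurcations.eq_zero_of_mem_component (hV : NoBifurcations V) {n : ℤ}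
    {x : LeavittPathAlgebra K V} (hx : x ∈ component K V n)
    (h : ∀ a b, hV.coeff K a b n x = 0) : x = 0 := by
  refine eq_zero_of_vertex_mul fun a => eq_zero_of_mul_vertex fun b => ?_
  obtain h0 | ⟨c, α, β, -, h0⟩ := hV.vertex_mul_mul_vertex a b hx
  · exact h0
  · rw [h0, h, zero_smul]

/-- Coefficients of different degrees do not interfere, so each homogeneous part has zero
coefficients, and every corner of such a part is its coefficient times one monomial. -/
theorem NoBifurcations.eq_zero_of_coeff (hV : NoBifurcations V) {x : LeavittPathAlgebra K V}
    (h : ∀ a b n, hV.coeff K a b n x = 0) : x = 0 := by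
  obtain ⟨f, hf, rfl⟩ := exists_homogeneous_decomposition x
  exact Finset.sum_eq_zero fun n _ => hV.eq_zero_of_mem_component (hf n) fun a b => by
    rw [← hV.coeff_sum hf, h]

theorem NoBifurcations.mem_component_of_coeff (hV : NoBifurcations V) {n : ℤ}
    {x : LeavittPathAlgebra K V} (h : ∀ a b m, n ≠ m → hV.coeff K a b m x = 0) :
    x ∈ component K V n := by
  obtain ⟨f, hf, rfl⟩ := exists_homogeneous_decomposition x
  have h0 : ∀ m, n ≠ m → f m = 0 := fun m hm =>
    hV.eq_zero_of_mem_component (hf m) fun a b => by rw [← hV.coeff_sum hf, h a b m hm]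
  rw [Finsupp.sum, Finset.sum_eq_single n (fun m _ hm => h0 m hm.symm)
    (fun hn => Finsupp.notMem_support_iff.1 hn)]
  exact hf n

theorem NoBifurcations.vertex_ne_zero (hV : NoBifurcations V) (a : V) : vertex K a ≠ 0 := by
  classical
  intro h
  have := hV.coeff_monomial (K := K) a a 0 (.nil : Quiver.Path a a) .nil
  rw [monomial_nil, h, map_zero] at this
  simp at this

end Coefficients

/-! ### Graded simple corners and graded semisimplicity -/

section GradedSimple

variable (K : Type*) [Field K] {V : Type u} [Quiver.{v} V]

theorem isLeftIdeal_leftCorner (a : V) : IsLeftIdeal (leftCorner K a) :=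
  fun y x hx => show y * x * _ = _ by rw [mul_assoc, mem_leftCorner.1 hx]

theorem isRightIdeal_rightCorner (a : V) : IsRightIdeal (rightCorner K a) :=
  fun y x hx => show _ * (x * y) = _ by rw [← mul_assoc, mem_rightCorner.1 hx]

theorem isHomogeneous_leftCorner (a : V) :
    IsHomogeneous (component K V) (leftCorner K a) := by
  intro x hx
  rw [← mem_leftCorner.1 hx]
  refine monomial_induction
    (P := fun x => x * vertex K a ∈ ⨆ n, leftCorner K a ⊓ component K V n) ?_ ?_ ?_ ?_ x
  · intro b b' c α β
    by_cases h : b' = a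
    · subst h
      rw [monomial_mul_vertex]
      exact Submodule.mem_iSup_of_mem _ ⟨monomial_mem_leftCorner α β, monomial_mem_component α β⟩
    · rw [monomial_mul_vertex_of_ne h]
      exact zero_mem _
  · rw [zero_mul]
    exact zero_mem _
  · intro x y hx hy
    rw [add_mul]
    exact add_mem hx hy
  · intro k x hx
    rw [smul_mul_assoc]
    exact Submodule.smul_mem _ k hx

theorem isHomogeneous_rightCorner (a : V) :
    IsHomogeneous (component K V) (rightCorner K a) := by
  intro x hx
  rw [← mem_rightCorner.1 hx]
  refine monomial_induction
    (P := fun x => vertex K a * x ∈ ⨆ n, rightCorner K a ⊓ component K V n) ?_ ?_ ?_ ?_ x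
  · intro b b' c α β
    by_cases h : a = b
    · subst h
      rw [vertex_mul_monomial]
      exact Submodule.mem_iSup_of_mem _ ⟨monomial_mem_rightCorner α β, monomial_mem_component α β⟩
    · rw [vertex_mul_monomial_of_ne h]
      exact zero_mem _
  · rw [mul_zero]
    exact zero_mem _
  · intro x y hx hy
    rw [mul_add]
    exact add_mem hx hy
  · intro k x hx
    rw [mul_smul_comm]
    exact Submodule.smul_mem _ k hx

theorem exists_homogeneous_ne_zero {A : Type*} [AddCommGroup A] [Module K A]
    {𝒜 : ℤ → Submodule K A} {J : Submodule K A}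
    (hJ : J ≤ ⨆ n, J ⊓ 𝒜 n) (h : J ≠ ⊥) : ∃ n, ∃ x ∈ J, x ∈ 𝒜 n ∧ x ≠ 0 := by
  by_contra! hc
  refine h (eq_bot_iff.2 (hJ.trans (iSup_le fun n x hx => ?_)))
  exact hc n x hx.1 hx.2

variable {K}

/-- A nonzero homogeneous `x` in `J` has some `b x = b x a ≠ 0`, a nonzero multiple of a monomial.
Its inverse monomial carries it to the vertex `a`, which generates the whole corner. -/
theorem NoBifurcations.isGradedSimpleLeft (hV : NoBifurcations V) (a : V) :
    IsGradedSimpleLeft (component K V) (leftCorner K a) where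
  isLeftIdeal := isLeftIdeal_leftCorner K a
  isHomogeneous := isHomogeneous_leftCorner K a
  mul_ne_zero := ⟨vertex K a, vertex K a, vertex_mul_self a, by
    rw [vertex_mul_self]; exact hV.vertex_ne_zero a⟩
  eq_bot_or_eq J hJ hleft hhom := by
    refine or_iff_not_imp_left.2 fun hbot => le_antisymm hJ fun y hy => ?_
    obtain ⟨n, x, hxJ, hxn, hx⟩ := exists_homogeneous_ne_zero K hhom hbot
    have hmem : vertex K a ∈ J := by
      obtain ⟨b, hb⟩ : ∃ b, vertex K b * x ≠ 0 := by
        by_contra! h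
        exact hx (eq_zero_of_vertex_mul h)
      have hxa : vertex K b * x * vertex K a = vertex K b * x := by
        rw [mul_assoc, mem_leftCorner.1 (hJ hxJ)]
      obtain h0 | ⟨c, α, β, -, h0⟩ := hV.vertex_mul_mul_vertex b a hxn
      · exact absurd (hxa.symm.trans h0) hb
      · have hk : hV.coeff K b a n x ≠ 0 := by
          intro hk
          rw [hk, zero_smul, hxa] at h0
          exact hb h0
        have := J.smul_mem (hV.coeff K b a n x)⁻¹ (hleft (monomial K β α) _ (hleft (vertex K b) x hxJ))
        rwa [← hxa, h0, mul_smul_comm, hV.monomial_mul_monomial, inv_smul_smul₀ hk] at this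
    rw [← mem_leftCorner.1 hy]
    exact hleft y _ hmem

theorem NoBifurcations.isGradedSimpleRight (hV : NoBifurcations V) (a : V) :
    IsGradedSimpleRight (component K V) (rightCorner K a) where
  isRightIdeal := isRightIdeal_rightCorner K a
  isHomogeneous := isHomogeneous_rightCorner K a
  mul_ne_zero := ⟨vertex K a, vertex K a, vertex_mul_self a, by
    rw [vertex_mul_self]; exact hV.vertex_ne_zero a⟩
  eq_bot_or_eq J hJ hright hhom := by
    refine or_iff_not_imp_left.2 fun hbot => le_antisymm hJ fun y hy => ?_
    obtain ⟨n, x, hxJ, hxn, hx⟩ := exists_homogeneous_ne_zero K hhom hbot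
    have hmem : vertex K a ∈ J := by
      obtain ⟨b, hb⟩ : ∃ b, x * vertex K b ≠ 0 := by
        by_contra! h
        exact hx (eq_zero_of_mul_vertex h)
      have hxa : vertex K a * x * vertex K b = x * vertex K b := by
        rw [mem_rightCorner.1 (hJ hxJ)]
      obtain h0 | ⟨c, α, β, -, h0⟩ := hV.vertex_mul_mul_vertex a b hxn
      · exact absurd (hxa.symm.trans h0) hb
      · have hk : hV.coeff K a b n x ≠ 0 := by
          intro hk
          rw [hk, zero_smul, hxa] at h0
          exact hb h0
        have := J.smul_mem (hV.coeff K a b n x)⁻¹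
          (hright (monomial K β α) _ (hright (vertex K b) x hxJ))
        rwa [← hxa, h0, smul_mul_assoc, hV.monomial_mul_monomial, inv_smul_smul₀ hk] at this
    rw [← mem_rightCorner.1 hy]
    exact hright y _ hmem

variable (K) in
theorem NoBifurcations.isGradedSemisimple (hV : NoBifurcations V) :
    IsGradedSemisimple (component K V) := by
  refine ⟨⟨Set.range (leftCorner K), ?_, ?_, ?_⟩, ⟨Set.range (rightCorner K), ?_, ?_, ?_⟩⟩
  · rintro _ ⟨a, rfl⟩
    exact hV.isGradedSimpleLeft a
  · rintro _ ⟨a, rfl⟩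
    rw [Submodule.disjoint_def]
    intro x hx hx'
    -- Independence concerns a set of submodules: a corner different from the one at `a` belongs to
    -- a vertex `b ≠ a`, and all such corners are killed by right multiplication by `a`.
    have hle : sSup (Set.range (leftCorner K) \ {leftCorner K a}) ≤
        ⨆ b ∈ ({a}ᶜ : Set V), leftCorner K b := by
      refine sSup_le ?_
      rintro _ ⟨⟨b, rfl⟩, hb⟩
      exact le_iSup₂_of_le b (by rintro rfl; exact hb rfl) le_rfl
    rw [← mem_leftCorner.1 hx]
    exact mul_vertex_eq_zero_of_mem (s := {a}ᶜ) (fun h => h rfl) (hle hx')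
  · rw [sSup_range, iSup_leftCorner]
  · rintro _ ⟨a, rfl⟩
    exact hV.isGradedSimpleRight a
  · rintro _ ⟨a, rfl⟩
    rw [Submodule.disjoint_def]
    intro x hx hx'
    have hle : sSup (Set.range (rightCorner K) \ {rightCorner K a}) ≤
        ⨆ b ∈ ({a}ᶜ : Set V), rightCorner K b := by
      refine sSup_le ?_
      rintro _ ⟨⟨b, rfl⟩, hb⟩
      exact le_iSup₂_of_le b (by rintro rfl; exact hb rfl) le_rfl
    rw [← mem_rightCorner.1 hx]
    exact vertex_mul_eq_zero_of_mem (s := {a}ᶜ) (fun h => h rfl) (hle hx')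
  · rw [sSup_range, iSup_rightCorner]

end GradedSimple

/-! ### Splittings from complements -/

section Splitting

variable {K A : Type*} [Field K] [NonUnitalRing A] [Module K A]

/-- The last clause, uniqueness of the representative in `C`, is what makes the section respect
products and degrees when `C` does. -/
theorem exists_section_of_isCompl {I C : Submodule K A} (h : IsCompl I C) :
    ∃ σ : (A ⧸ I) →ₗ[K] A, (∀ y, I.mkQ (σ y) = y) ∧ (∀ y, σ y ∈ C) ∧
      ∀ x, ∀ c ∈ C, x - c ∈ I → σ (I.mkQ x) = c := by
  let σ : (A ⧸ I) →ₗ[K] A := C.subtype ∘ₗ (Submodule.quotientEquivOfIsCompl I C h).toLinearMap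
  have hσ : ∀ y, I.mkQ (σ y) = y := fun y =>
    (Submodule.quotientEquivOfIsCompl I C h).symm_apply_apply y
  have hσC : ∀ y, σ y ∈ C := fun y => (Submodule.quotientEquivOfIsCompl I C h y).2
  refine ⟨σ, hσ, hσC, fun x c hc hxc => ?_⟩
  have h1 : x - σ (I.mkQ x) ∈ I :=
    (Submodule.Quotient.eq I).1 (hσ (I.mkQ x)).symm
  refine sub_eq_zero.1 (Submodule.disjoint_def.1 h.disjoint _ ?_ (sub_mem (hσC _) hc))
  have := sub_mem hxc h1
  rwa [sub_sub_sub_cancel_left] at this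

theorem SplitsLeft.of_isCompl {𝒜 : ℤ → Submodule K A} {I C : Submodule K A} (h : IsCompl I C)
    (hI : IsLeftIdeal I) (hC : IsLeftIdeal C)
    (hdeg : ∀ n, ∀ x ∈ 𝒜 n, ∃ c ∈ C, c ∈ 𝒜 n ∧ x - c ∈ I) : SplitsLeft 𝒜 I := by
  obtain ⟨σ, hσ, hσC, hσu⟩ := exists_section_of_isCompl h
  refine ⟨σ, hσ, fun a x => hσu _ _ (hC a _ (hσC _)) ?_, fun n x hx => ?_⟩
  · rw [← mul_sub]
    exact hI a _ ((Submodule.Quotient.eq I).1 (hσ (I.mkQ x)).symm)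
  · obtain ⟨c, hc, hcn, hxc⟩ := hdeg n x hx
    rwa [hσu x c hc hxc]

theorem SplitsRight.of_isCompl {𝒜 : ℤ → Submodule K A} {I C : Submodule K A} (h : IsCompl I C)
    (hI : IsRightIdeal I) (hC : IsRightIdeal C)
    (hdeg : ∀ n, ∀ x ∈ 𝒜 n, ∃ c ∈ C, c ∈ 𝒜 n ∧ x - c ∈ I) : SplitsRight 𝒜 I := by
  obtain ⟨σ, hσ, hσC, hσu⟩ := exists_section_of_isCompl h
  refine ⟨σ, hσ, fun a x => hσu _ _ (hC a _ (hσC _)) ?_, fun n x hx => ?_⟩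
  · rw [← sub_mul]
    exact hI a _ ((Submodule.Quotient.eq I).1 (hσ (I.mkQ x)).symm)
  · obtain ⟨c, hc, hcn, hxc⟩ := hdeg n x hx
    rwa [hσu x c hc hxc]

theorem IsLeftIdeal.iSup {ι : Sort*} {I : ι → Submodule K A} (h : ∀ i, IsLeftIdeal (I i)) :
    IsLeftIdeal (⨆ i, I i) := by
  intro a x hx
  refine Submodule.iSup_induction (motive := fun x => a * x ∈ ⨆ i, I i) _ hx
    (fun i x hx => Submodule.mem_iSup_of_mem i (h i a x hx)) ?_ ?_
  · rw [mul_zero]; exact zero_mem _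
  · intro x y hx hy; rw [mul_add]; exact add_mem hx hy

theorem IsRightIdeal.iSup {ι : Sort*} {I : ι → Submodule K A} (h : ∀ i, IsRightIdeal (I i)) :
    IsRightIdeal (⨆ i, I i) := by
  intro a x hx
  refine Submodule.iSup_induction (motive := fun x => x * a ∈ ⨆ i, I i) _ hx
    (fun i x hx => Submodule.mem_iSup_of_mem i (h i a x hx)) ?_ ?_
  · rw [zero_mul]; exact zero_mem _
  · intro x y hx hy; rw [add_mul]; exact add_mem hx hy

theorem IsHomogeneous.iSup {ι : Sort*} {𝒜 : ℤ → Submodule K A} {I : ι → Submodule K A}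
    (h : ∀ i, IsHomogeneous 𝒜 (I i)) : IsHomogeneous 𝒜 (⨆ i, I i) :=
  iSup_le fun i => (h i).trans (iSup_mono fun _ => inf_le_inf_right _ (le_iSup I i))

end Splitting

/-! ### Complementary sums of corners -/

section Corners

variable {K : Type*} [Field K] {V : Type u} [Quiver.{v} V]

/-- An element of both sums is killed on the right by every vertex: vertices in `s` kill the second
sum, the others kill the first. -/
theorem isCompl_leftCorner (s : Set V) :
    IsCompl (⨆ a ∈ s, leftCorner K a) (⨆ a ∈ sᶜ, leftCorner K a) := by
  refine ⟨Submodule.disjoint_def.2 fun x hx hx' => eq_zero_of_mul_vertex fun a => ?_,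
    codisjoint_iff_le_sup.2 ?_⟩
  · by_cases ha : a ∈ s
    · exact mul_vertex_eq_zero_of_mem (s := sᶜ) (fun h => h ha) hx'
    · exact mul_vertex_eq_zero_of_mem ha hx
  · rw [← iSup_leftCorner K V]
    refine iSup_le fun a => ?_
    by_cases ha : a ∈ s
    · exact le_sup_of_le_left (le_iSup₂_of_le a ha le_rfl)
    · exact le_sup_of_le_right (le_iSup₂_of_le a ha le_rfl)

theorem isCompl_rightCorner (s : Set V) :
    IsCompl (⨆ a ∈ s, rightCorner K a) (⨆ a ∈ sᶜ, rightCorner K a) := by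
  refine ⟨Submodule.disjoint_def.2 fun x hx hx' => eq_zero_of_vertex_mul fun a => ?_,
    codisjoint_iff_le_sup.2 ?_⟩
  · by_cases ha : a ∈ s
    · exact vertex_mul_eq_zero_of_mem (s := sᶜ) (fun h => h ha) hx'
    · exact vertex_mul_eq_zero_of_mem ha hx
  · rw [← iSup_rightCorner K V]
    refine iSup_le fun a => ?_
    by_cases ha : a ∈ s
    · exact le_sup_of_le_left (le_iSup₂_of_le a ha le_rfl)
    · exact le_sup_of_le_right (le_iSup₂_of_le a ha le_rfl)

/-- When every monomial lies in `I` or in `C`, reduction modulo `I` amounts to deleting the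
monomials in `I`, which preserves degree. -/
theorem exists_mem_component_sub_mem {I C : Submodule K (LeavittPathAlgebra K V)}
    (h : ∀ (a b c : V) (α : Quiver.Path a c) (β : Quiver.Path b c),
      monomial K α β ∈ I ∨ monomial K α β ∈ C)
    {n : ℤ} {x : LeavittPathAlgebra K V} (hx : x ∈ component K V n) :
    ∃ c ∈ C, c ∈ component K V n ∧ x - c ∈ I := by
  refine component_induction (P := fun x => ∃ c ∈ C, c ∈ component K V n ∧ x - c ∈ I)
    ?_ ?_ ?_ ?_ hx
  · rintro a b c α β rfl
    obtain h | h := h a b c α β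
    · exact ⟨0, zero_mem _, zero_mem _, by rwa [sub_zero]⟩
    · exact ⟨_, h, monomial_mem_component α β, by rw [sub_self]; exact zero_mem _⟩
  · exact ⟨0, zero_mem _, zero_mem _, by rw [sub_zero]; exact zero_mem _⟩
  · rintro x y ⟨c, hc, hcn, hxc⟩ ⟨d, hd, hdn, hyd⟩
    exact ⟨c + d, add_mem hc hd, add_mem hcn hdn, by
      rw [add_sub_add_comm]; exact add_mem hxc hyd⟩
  · rintro k x ⟨c, hc, hcn, hxc⟩
    exact ⟨k • c, C.smul_mem k hc, Submodule.smul_mem _ k hcn, by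
      rw [← smul_sub]; exact I.smul_mem k hxc⟩

theorem splitsLeft_leftCorner (s : Set V) :
    SplitsLeft (component K V) (⨆ a ∈ s, leftCorner K a) := by
  have hideal : ∀ s : Set V, IsLeftIdeal (⨆ a ∈ s, leftCorner K a) := fun s =>
    .iSup fun a => .iSup fun _ => isLeftIdeal_leftCorner K a
  refine .of_isCompl (isCompl_leftCorner s) (hideal s) (hideal sᶜ) fun n x hx =>
    exists_mem_component_sub_mem (fun a b c α β => ?_) hx
  by_cases hb : b ∈ s
  · exact .inl (Submodule.mem_iSup_of_mem b (Submodule.mem_iSup_of_mem hb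
      (monomial_mem_leftCorner α β)))
  · exact .inr (Submodule.mem_iSup_of_mem b (Submodule.mem_iSup_of_mem hb
      (monomial_mem_leftCorner α β)))

theorem splitsRight_rightCorner (s : Set V) :
    SplitsRight (component K V) (⨆ a ∈ s, rightCorner K a) := by
  have hideal : ∀ s : Set V, IsRightIdeal (⨆ a ∈ s, rightCorner K a) := fun s =>
    .iSup fun a => .iSup fun _ => isRightIdeal_rightCorner K a
  refine .of_isCompl (isCompl_rightCorner s) (hideal s) (hideal sᶜ) fun n x hx =>
    exists_mem_component_sub_mem (fun a b c α β => ?_) hx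
  by_cases ha : a ∈ s
  · exact .inl (Submodule.mem_iSup_of_mem a (Submodule.mem_iSup_of_mem ha
      (monomial_mem_rightCorner α β)))
  · exact .inr (Submodule.mem_iSup_of_mem a (Submodule.mem_iSup_of_mem ha
      (monomial_mem_rightCorner α β)))

end Corners

/-! ### The diagonal ideal and the diagonal embedding -/

section Diagonal

variable (K : Type*) [Field K] {V : Type u} [Quiver.{v} V]

variable (V) in
/-- The diagonal vertices `[a, a]` of the Kronecker square. -/
def diagonalVertices : Set (KroneckerSquare V) := Set.range fun a : V => ⟨a, a⟩

theorem vertex_mem_diagonalSubalgebra (a : V) :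
    vertex K (⟨a, a⟩ : KroneckerSquare V) ∈ diagonalSubalgebra K V :=
  NonUnitalAlgebra.subset_adjoin K (.inl (.inl ⟨a, rfl⟩))

theorem arrow_mem_diagonalSubalgebra (e : Quiver.Total V) :
    arrow K (pairArrow e e) ∈ diagonalSubalgebra K V :=
  NonUnitalAlgebra.subset_adjoin K (.inl (.inr ⟨e, rfl⟩))

theorem ghost_mem_diagonalSubalgebra (e : Quiver.Total V) :
    ghost K (pairArrow e e) ∈ diagonalSubalgebra K V :=
  NonUnitalAlgebra.subset_adjoin K (.inr ⟨e, rfl⟩)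

/-- Each generator of the subalgebra is fixed on the right by a diagonal vertex, and the sum of left
corners, a left ideal, absorbs products. Conversely `x = x [a, a]` lies in the left ideal because
`[a, a]` does. -/
theorem diagonalSubalgebra_eq_iSup_leftCorner
    (hleft : IsLeftIdeal (diagonalSubalgebra K V).toSubmodule) :
    (diagonalSubalgebra K V).toSubmodule = ⨆ a ∈ diagonalVertices V, leftCorner K a := by
  have hmem : ∀ a : V, ∀ x ∈ leftCorner K (⟨a, a⟩ : KroneckerSquare V),
      x ∈ ⨆ a ∈ diagonalVertices V, leftCorner K a := fun a x hx =>
    Submodule.mem_iSup_of_mem _ (Submodule.mem_iSup_of_mem ⟨a, rfl⟩ hx)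
  refine le_antisymm (fun x hx => ?_) (iSup₂_le ?_)
  · refine NonUnitalAlgebra.adjoin_induction
      (p := fun x _ => x ∈ ⨆ a ∈ diagonalVertices V, leftCorner K a) ?_
      (fun _ _ _ _ => add_mem) (zero_mem _) (fun x y _ _ _ hy => ?_)
      (fun k _ _ => Submodule.smul_mem _ k) hx
    · rintro _ ((⟨a, rfl⟩ | ⟨e, rfl⟩) | ⟨e, rfl⟩)
      · exact hmem a _ (vertex_mul_self _)
      · exact hmem e.right _ (arrow_mul_right (pairArrow e e))
      · exact hmem e.left _ (ghost_mul_left (pairArrow e e))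
    · exact IsLeftIdeal.iSup (fun a => IsLeftIdeal.iSup fun _ => isLeftIdeal_leftCorner K a)
        x y hy
  · rintro _ ⟨a, rfl⟩ x hx
    rw [← mem_leftCorner.1 hx]
    exact hleft x _ (vertex_mem_diagonalSubalgebra K a)

theorem diagonalSubalgebra_eq_iSup_rightCorner
    (hright : IsRightIdeal (diagonalSubalgebra K V).toSubmodule) :
    (diagonalSubalgebra K V).toSubmodule = ⨆ a ∈ diagonalVertices V, rightCorner K a := by
  have hmem : ∀ a : V, ∀ x ∈ rightCorner K (⟨a, a⟩ : KroneckerSquare V),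
      x ∈ ⨆ a ∈ diagonalVertices V, rightCorner K a := fun a x hx =>
    Submodule.mem_iSup_of_mem _ (Submodule.mem_iSup_of_mem ⟨a, rfl⟩ hx)
  refine le_antisymm (fun x hx => ?_) (iSup₂_le ?_)
  · refine NonUnitalAlgebra.adjoin_induction
      (p := fun x _ => x ∈ ⨆ a ∈ diagonalVertices V, rightCorner K a) ?_
      (fun _ _ _ _ => add_mem) (zero_mem _) (fun x y _ _ hx _ => ?_)
      (fun k _ _ => Submodule.smul_mem _ k) hx
    · rintro _ ((⟨a, rfl⟩ | ⟨e, rfl⟩) | ⟨e, rfl⟩)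
      · exact hmem a _ (vertex_mul_self _)
      · exact hmem e.left _ (left_mul_arrow (pairArrow e e))
      · exact hmem e.right _ (right_mul_ghost (pairArrow e e))
    · exact IsRightIdeal.iSup (fun a => IsRightIdeal.iSup fun _ => isRightIdeal_rightCorner K a)
        y x hx
  · rintro _ ⟨a, rfl⟩ x hx
    rw [← mem_rightCorner.1 hx]
    exact hright x _ (vertex_mem_diagonalSubalgebra K a)

variable (V) in
/-- The diagonal embedding of a quiver into its Kronecker square. -/
def diagonalPrefunctor : V ⥤q KroneckerSquare V where
  obj a := ⟨a, a⟩
  map e := (e, e)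

theorem length_mapPath {W : Type*} [Quiver W] (F : V ⥤q W) {a b : V} (p : Quiver.Path a b) :
    (F.mapPath p).length = p.length := by
  induction p with
  | nil => rfl
  | cons p e ih => rw [Prefunctor.mapPath_cons, Quiver.Path.length_cons, ih,
      Quiver.Path.length_cons]

variable {K} in
theorem IsDiagonal.map_pathElt
    {φ : LeavittPathAlgebra K V →ₙₐ[K] LeavittPathAlgebra K (KroneckerSquare V)}
    (hφ : IsDiagonal K φ) {a b : V} (p : Quiver.Path a b) :
    φ (pathElt K p) = pathElt K ((diagonalPrefunctor V).mapPath p) := by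
  induction p with
  | nil => exact hφ.1 a
  | cons p e ih =>
    rw [pathElt, map_mul, ih, hφ.2.1]
    rfl

variable {K} in
theorem IsDiagonal.map_ghostPathElt
    {φ : LeavittPathAlgebra K V →ₙₐ[K] LeavittPathAlgebra K (KroneckerSquare V)}
    (hφ : IsDiagonal K φ) {a b : V} (p : Quiver.Path a b) :
    φ (ghostPathElt K p) = ghostPathElt K ((diagonalPrefunctor V).mapPath p) := by
  induction p with
  | nil => exact hφ.1 a
  | cons p e ih =>
    rw [ghostPathElt, map_mul, ih, hφ.2.2]
    rfl

variable {K} in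
theorem IsDiagonal.map_monomial
    {φ : LeavittPathAlgebra K V →ₙₐ[K] LeavittPathAlgebra K (KroneckerSquare V)}
    (hφ : IsDiagonal K φ) {a b c : V} (α : Quiver.Path a c) (β : Quiver.Path b c) :
    φ (monomial K α β) = monomial K ((diagonalPrefunctor V).mapPath α)
      ((diagonalPrefunctor V).mapPath β) := by
  rw [monomial, map_mul, hφ.map_pathElt, hφ.map_ghostPathElt]
  rfl

/-- Only the Cuntz-Krieger relation needs the absence of bifurcations: with it, `[e, e]` is the only
arrow leaving `[s(e), s(e)]`, so no mixed arrows `[e, f]` are missing from the sum. -/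
theorem NoBifurcations.exists_isDiagonal (hV : NoBifurcations V) :
    ∃ φ : LeavittPathAlgebra K V →ₙₐ[K] LeavittPathAlgebra K (KroneckerSquare V),
      IsDiagonal K φ := by
  have hfam : IsLeavittFamily (fun a : V => vertex K (⟨a, a⟩ : KroneckerSquare V))
      (fun e => arrow K (pairArrow e e)) (fun e => ghost K (pairArrow e e)) :=
    { vertex_mul_self := fun a => Leavitt.vertex_mul_self _
      vertex_mul_vertex := fun a b hab =>
        vertex_mul_of_ne fun h => hab (congrArg KroneckerSquare.fst h)
      left_mul_arrow := fun e => Leavitt.left_mul_arrow (pairArrow e e)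
      arrow_mul_right := fun e => Leavitt.arrow_mul_right (pairArrow e e)
      right_mul_ghost := fun e => Leavitt.right_mul_ghost (pairArrow e e)
      ghost_mul_left := fun e => Leavitt.ghost_mul_left (pairArrow e e)
      ghost_mul_arrow_self := fun e => Leavitt.ghost_mul_arrow_self (pairArrow e e)
      ghost_mul_arrow := fun e f hef =>
        ghost_mul_arrow_of_ne fun h => hef (pairArrow_injective h).1
      cuntz_krieger := by
        rintro a ⟨⟨e, rfl⟩, hfin⟩
        rw [Finset.sum_eq_single e]
        · exact (hV.kroneckerSquare.arrow_mul_ghost (pairArrow e e)).symm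
        · exact fun f hf hfe =>
            absurd (hV f e (show f ∈ emitted e.left from hfin.mem_toFinset.1 hf)) hfe
        · exact fun h => absurd (hfin.mem_toFinset.2 (show e ∈ emitted e.left from rfl)) h }
  exact ⟨hfam.lift, hfam.lift_vertex, hfam.lift_arrow, hfam.lift_ghost⟩

variable {K}

/-- The diagonal map sends monomials to monomials of the same degree between the corresponding
diagonal vertices. Injectivity and the reflection of degrees are read off from this. -/
theorem IsDiagonal.coeff_map (hV : NoBifurcations V)
    {φ : LeavittPathAlgebra K V →ₙₐ[K] LeavittPathAlgebra K (KroneckerSquare V)}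
    (hφ : IsDiagonal K φ) (a b : V) (n : ℤ) (x : LeavittPathAlgebra K V) :
    hV.kroneckerSquare.coeff K ⟨a, a⟩ ⟨b, b⟩ n (φ x) = hV.coeff K a b n x := by
  classical
  refine monomial_induction (P := fun x =>
    hV.kroneckerSquare.coeff K ⟨a, a⟩ ⟨b, b⟩ n (φ x) = hV.coeff K a b n x) ?_ ?_ ?_ ?_ x
  · intro a' b' c α β
    rw [hφ.map_monomial, NoBifurcations.coeff_monomial, NoBifurcations.coeff_monomial,
      length_mapPath, length_mapPath]
    simp [diagonalPrefunctor]
  · rw [map_zero, map_zero, map_zero]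
  · intro x y hx hy
    rw [map_add, map_add, map_add, hx, hy]
  · intro k x hx
    rw [map_smul, map_smul, map_smul, hx]

theorem IsDiagonal.injective (hV : NoBifurcations V)
    {φ : LeavittPathAlgebra K V →ₙₐ[K] LeavittPathAlgebra K (KroneckerSquare V)}
    (hφ : IsDiagonal K φ) : Function.Injective φ :=
  (injective_iff_map_eq_zero φ).2 fun x hx => hV.eq_zero_of_coeff fun a b n => by
    rw [← hφ.coeff_map hV, hx, map_zero]

theorem IsDiagonal.map_mem_component_iff (hV : NoBifurcations V)
    {φ : LeavittPathAlgebra K V →ₙₐ[K] LeavittPathAlgebra K (KroneckerSquare V)}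
    (hφ : IsDiagonal K φ) (n : ℤ) (x : LeavittPathAlgebra K V) :
    φ x ∈ component K (KroneckerSquare V) n ↔ x ∈ component K V n := by
  constructor
  · refine fun h => hV.mem_component_of_coeff fun a b m hm => ?_
    rw [← hφ.coeff_map hV, hV.kroneckerSquare.coeff_of_mem_component hm h]
  · refine component_induction (P := fun x => φ x ∈ component K (KroneckerSquare V) n) ?_ ?_ ?_ ?_
    · rintro a b c α β rfl
      rw [hφ.map_monomial, ← length_mapPath (diagonalPrefunctor V) α,
        ← length_mapPath (diagonalPrefunctor V) β]
      exact monomial_mem_component _ _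
    · rw [map_zero]
      exact zero_mem _
    · intro x y hx hy
      rw [map_add]
      exact add_mem hx hy
    · intro k x hx
      rw [map_smul]
      exact Submodule.smul_mem _ k hx

theorem IsDiagonal.range_eq
    {φ : LeavittPathAlgebra K V →ₙₐ[K] LeavittPathAlgebra K (KroneckerSquare V)}
    (hφ : IsDiagonal K φ) (y : LeavittPathAlgebra K (KroneckerSquare V)) :
    y ∈ diagonalSubalgebra K V ↔ y ∈ Set.range φ := by
  constructor
  · have hle : diagonalSubalgebra K V ≤ NonUnitalAlgHom.range φ := by
      refine NonUnitalAlgebra.adjoin_le ?_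
      rintro _ ((⟨a, rfl⟩ | ⟨e, rfl⟩) | ⟨e, rfl⟩)
      exacts [⟨_, hφ.1 a⟩, ⟨_, hφ.2.1 e⟩, ⟨_, hφ.2.2 e⟩]
    exact fun hy => hle hy
  · rintro ⟨x, rfl⟩
    induction x using LeavittPathAlgebra.induction with
    | hv a => rw [hφ.1]; exact vertex_mem_diagonalSubalgebra K a
    | ha e => rw [hφ.2.1]; exact arrow_mem_diagonalSubalgebra K e
    | hg e => rw [hφ.2.2]; exact ghost_mem_diagonalSubalgebra K e
    | hzero => rw [map_zero]; exact zero_mem _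
    | hadd x y hx hy => rw [map_add]; exact add_mem hx hy
    | hmul x y hx hy => rw [map_mul]; exact mul_mem hx hy
    | hsmul k x hx => rw [map_smul]; exact SMulMemClass.smul_mem k hx

end Diagonal

end Leavitt

/-! ### The main theorem -/

theorem mainTheorem7 (K : Type*) [Field K] (V : Type u) [Quiver.{v} V]
    (hleft : Leavitt.IsLeftIdeal (Leavitt.diagonalSubalgebra K V).toSubmodule)
    (hright : Leavitt.IsRightIdeal (Leavitt.diagonalSubalgebra K V).toSubmodule) :
    (∀ a : V, Leavitt.IsSink a ∨ Leavitt.IsRayPoint a ∨ Leavitt.IsLaurentVertex a) ∧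
    Leavitt.IsGradedSemisimple (Leavitt.component K (Leavitt.KroneckerSquare V)) ∧
    (∃ φ : Leavitt.LeavittPathAlgebra K V →ₙₐ[K]
        Leavitt.LeavittPathAlgebra K (Leavitt.KroneckerSquare V),
      Leavitt.IsDiagonal K φ ∧
      (∀ (n : ℤ) (x : Leavitt.LeavittPathAlgebra K V),
        φ x ∈ Leavitt.component K (Leavitt.KroneckerSquare V) n ↔
          x ∈ Leavitt.component K V n) ∧
      Function.Injective φ ∧
      Function.Exact φ (Leavitt.diagonalSubalgebra K V).toSubmodule.mkQ ∧
      Function.Surjective (Leavitt.diagonalSubalgebra K V).toSubmodule.mkQ ∧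
      Leavitt.IsHomogeneous (Leavitt.component K (Leavitt.KroneckerSquare V))
        (Leavitt.diagonalSubalgebra K V).toSubmodule ∧
      Leavitt.SplitsLeft (Leavitt.component K (Leavitt.KroneckerSquare V))
        (Leavitt.diagonalSubalgebra K V).toSubmodule ∧
      Leavitt.SplitsRight (Leavitt.component K (Leavitt.KroneckerSquare V))
        (Leavitt.diagonalSubalgebra K V).toSubmodule) := by
  have hV : Leavitt.NoBifurcations V := fun _ _ h =>
    Leavitt.left_injective_of_isRightIdeal K hright h
  obtain ⟨φ, hφ⟩ := hV.exists_isDiagonal K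
  -- A sink needs no case of its own, since it is also a ray point.
  refine ⟨fun a => .inr (hV.isRayPoint_or_isLaurentVertex a),
    hV.kroneckerSquare.isGradedSemisimple K, φ, hφ, hφ.map_mem_component_iff hV,
    hφ.injective hV, fun y => ?_, Submodule.mkQ_surjective _, ?_, ?_, ?_⟩
  -- Exactness in the middle says that the image of `φ` is the diagonal subalgebra.
  · rw [← LinearMap.mem_ker, Submodule.ker_mkQ]
    exact hφ.range_eq y
  · rw [Leavitt.diagonalSubalgebra_eq_iSup_leftCorner K hleft]
    exact .iSup fun a => .iSup fun _ => Leavitt.isHomogeneous_leftCorner K a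
  · rw [Leavitt.diagonalSubalgebra_eq_iSup_leftCorner K hleft]
    exact Leavitt.splitsLeft_leftCorner _
  · rw [Leavitt.diagonalSubalgebra_eq_iSup_rightCorner K hright]
    exact Leavitt.splitsRight_rightCorner _
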